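/- Let $\mathfrak n$ be a finite-dimensional associative nilpotent algebra over a finite field $\mathbb F_q$, and let $G=1+\mathfrak n$ be the corresponding algebra group, i.e. the set of formal sums $1+X$ ($X\in\mathfrak n$) with $(1+X)(1+Y)=1+X+Y+XY$; for a subalgebra $\mathfrak h\subset\mathfrak n$ the algebra group $1+\mathfrak h$ is a subgroup of $G$. For any algebra group $G = 1+\mathfrak n$ over $\mathbb F_q$, $g\in G$ and $\lambda\in\mathfrak n^*$ (the $\mathbb F_q$-linear dual), let $(\lambda g)(X)=\lambda(Xg^{-1})$ and $\lambda^g(X)=\lambda(gXg^{-1})$ for $X\in\mathfrak n$, and write $\lambda H=\{\lambda h: h\in H\}$ for a subgroup $H\subset G$ and $\lambda^G=\{\lambda^g:g\in G\}$. Fix a nontrivial homomorphism $\theta:\mathbb F_q^+\to\mathbb C^\times$, put $\theta_\lambda(g)=\theta(\lambda(g-1))$ for $g \in G$, and define the Kirillov function $\psi_\lambda=|\lambda^G|^{-1/2}\sum_{\nu\in\lambda^G}\theta_\nu$ on $G$. For a subgroup $H\subset G$ and a complex-valued function $f$ on $H$ put $\mathrm{Ind}_H^G(f)(g)=\frac1{|H|}\sum_{x\in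 G,\ xgx^{-1}\in H}f(xgx^{-1})$, and for functions $f,f':G\to\mathbb C$ put $\langle f,f'\rangle_G=\frac1{|G|}\sum_{x\in G}f(x)\overline{f'(x)}$. Let $\mathrm{Irr}(G)$ be the set of characters of irreducible complex representations of $G$. Given $\lambda\in\mathfrak n^*$, define $\mathfrak l^0_\lambda=0$, $\mathfrak s_\lambda^0=\mathfrak n$ and, for $i\ge 0$, \[\mathfrak l_\lambda^{i+1}=\{X\in\mathfrak s_\lambda^i:\lambda(XY)=0\ \text{for all } Y\in\mathfrak s_\lambda^i\},\qquad \mathfrak s_\lambda^{i+1}=\{X\in\mathfrak s_\lambda^i:\lambda(XY)=0\ \text{for all } Y\in\mathfrak l_\lambda^{i+1}\}.\] These are subalgebras of $\mathfrak n$ and both chains become stationary; let $\overline{\mathfrak l}_\lambda$ and $\overline{\mathfrak s}_\lambda$ be their terminal elements, i.e. $\overline{\mathfrak l}_\lambda=\mathfrak l_\lambda^d$ and $\overline{\mathfrak s}_\lambda=\mathfrak s_\lambda^d$ for any $d\ge1$ with $\mathfrak s_\lambda^{d-1}=\mathfrak s_\lambda^d$. Put $\overline L_\lambda=1+\overline{\mathfrak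 l}_\lambda$, $\overline S_\lambda=1+\overline{\mathfrak s}_\lambda$, and $\xi_\lambda=\mathrm{Ind}_{\overline L_\lambda}^G(\theta_\lambda|_{\overline L_\lambda})$. Let $\lambda,\lambda'\in\mathfrak n^*$ and let $\mu=\lambda|_{\overline{\mathfrak s}_\lambda}$ and $\mu'=\lambda'|_{\overline{\mathfrak s}_\lambda}$ in $(\overline{\mathfrak s}_\lambda)^*$. Then $\mu'\in\mu\overline S_\lambda$ if and only if $\lambda'\in\lambda\overline S_\lambda$, and in this case the following hold: (1) $\mathrm{Ind}_{\overline S_\lambda}^G(\psi_{\mu'})=\psi_{\lambda'}$, where $\psi_{\mu'}$ is the Kirillov function of the algebra group $\overline S_\lambda$, and $\langle\xi_\lambda,\psi_{\lambda'}\rangle_G$ is a positive integer. (2) $\psi_{\lambda'}\in\mathrm{Irr}(G)$ if and only if $\psi_{\mu'}\in\mathrm{Irr}(\overline S_\lambda)$. -/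

import Mathlib

/-- An associative (non-unital) algebra is nilpotent if, for some `k`, all products
`x₁ (x₂ (⋯ (x_k y)))` of `k + 1` elements vanish. -/
class IsNilpotentAlgebra (A : Type*) [NonUnitalRing A] : Prop where
  exists_prod_eq_zero : ∃ k : ℕ, ∀ l : List A, l.length = k → ∀ y : A, l.foldr (· * ·) y = 0

/-- The underlying set of the algebra group `1 + A`: the element `⟨X⟩` is the formal sum `1 + X`. -/
@[ext]
structure AlgebraGroup (A : Type*) where
  /-- The element `X = g - 1` for `g = 1 + X`. -/
  val : A

namespace AlgebraGroup

section Group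

variable {A : Type*} [NonUnitalRing A]

/-- `(1 + X)(1 + Y) = 1 + (X + Y + XY)`. -/
instance : Mul (AlgebraGroup A) := ⟨fun g h => ⟨g.val + h.val + g.val * h.val⟩⟩

instance : One (AlgebraGroup A) := ⟨⟨0⟩⟩

@[simp] theorem val_mul (g h : AlgebraGroup A) :
    (g * h).val = g.val + h.val + g.val * h.val := rfl

@[simp] theorem val_one : (1 : AlgebraGroup A).val = 0 := rfl

theorem exists_right_inverse [IsNilpotentAlgebra A] (g : AlgebraGroup A) :
    ∃ h : AlgebraGroup A, g * h = 1 := by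
  obtain ⟨k, hk⟩ := IsNilpotentAlgebra.exists_prod_eq_zero (A := A)
  obtain ⟨x⟩ := g
  let T : A → A := fun y => -x - x * y
  have hT : ∀ n : ℕ, T^[n + 1] 0 - T^[n] 0 = (List.replicate n (-x)).foldr (· * ·) (-x) := by
    intro n
    induction n with
    | zero => simp [T]
    | succ n ih =>
      rw [List.replicate_succ, List.foldr_cons, ← ih, Function.iterate_succ_apply' T (n + 1),
        Function.iterate_succ_apply' T n]
      simp only [T]
      noncomm_ring
  have h0 := hT k
  rw [hk _ (by simp), Function.iterate_succ_apply' T k] at h0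
  refine ⟨⟨T^[k] 0⟩, AlgebraGroup.ext ?_⟩
  change x + T^[k] 0 + x * T^[k] 0 = 0
  generalize T^[k] 0 = y at h0
  have hy : x + y + x * y = -(T y - y) := by simp only [T]; abel
  rw [hy, h0, neg_zero]

noncomputable instance [IsNilpotentAlgebra A] : Inv (AlgebraGroup A) :=
  ⟨fun g => (exists_right_inverse g).choose⟩

noncomputable instance [IsNilpotentAlgebra A] : Group (AlgebraGroup A) :=
  Group.ofRightAxioms
    (fun a b c => AlgebraGroup.ext (by simp only [val_mul, mul_add, add_mul, mul_assoc]; abel))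
    (fun a => AlgebraGroup.ext (by simp))
    (fun a => (exists_right_inverse a).choose_spec)

end Group

/-- A subalgebra of a nilpotent algebra is nilpotent. -/
instance {F A : Type*} [Field F] [NonUnitalRing A] [Module F A] [IsNilpotentAlgebra A]
    (B : NonUnitalSubalgebra F A) : IsNilpotentAlgebra B where
  exists_prod_eq_zero := by
    obtain ⟨k, hk⟩ := IsNilpotentAlgebra.exists_prod_eq_zero (A := A)
    refine ⟨k, fun l hl y => Subtype.ext ?_⟩
    have h : ∀ l : List B, ((l.foldr (· * ·) y : B) : A)
        = (l.map (fun b : B => (b : A))).foldr (· * ·) (y : A) := by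
      intro l
      induction l with
      | nil => rfl
      | cons a l ih => simp [ih]
    rw [h, hk _ (by simpa using hl)]
    rfl

variable {F A : Type*} [Field F] [NonUnitalRing A] [Module F A]

/-- For a subalgebra `B ⊆ A`, the inclusion of the algebra subgroup `1 + B` into `1 + A`. -/
noncomputable def incl [IsNilpotentAlgebra A] (B : NonUnitalSubalgebra F A) :
    AlgebraGroup B →* AlgebraGroup A where
  toFun g := ⟨(g.val : A)⟩
  map_one' := rfl
  map_mul' _ _ := rfl

/-- The restriction of a linear functional on `A` to a subalgebra `B`. -/
def res (lam : Module.Dual F A) (B : NonUnitalSubalgebra F A) : Module.Dual F B where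
  toFun X := lam (X : A)
  map_add' X Y := by simp
  map_smul' c X := by simp

section Actions

variable [IsScalarTower F A A] [SMulCommClass F A A]

/-- Left multiplication `X ↦ gX = X + (g - 1)X` by `g ∈ 1 + A` on `A`. -/
def leftMul (F : Type*) {A : Type*} [Field F] [NonUnitalRing A] [Module F A]
    [SMulCommClass F A A] (g : AlgebraGroup A) : A →ₗ[F] A where
  toFun X := X + g.val * X
  map_add' X Y := by rw [mul_add]; abel
  map_smul' c X := by simp [mul_smul_comm]

/-- Right multiplication `X ↦ Xg = X + X(g - 1)` by `g ∈ 1 + A` on `A`. -/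
def rightMul (F : Type*) {A : Type*} [Field F] [NonUnitalRing A] [Module F A]
    [IsScalarTower F A A] (g : AlgebraGroup A) : A →ₗ[F] A where
  toFun X := X + X * g.val
  map_add' X Y := by rw [add_mul]; abel
  map_smul' c X := by simp [smul_mul_assoc]

variable [IsNilpotentAlgebra A]

/-- The right action of `1 + A` on the dual space: `(λg)(X) = λ(X g⁻¹)`. -/
noncomputable def rightAct (lam : Module.Dual F A) (g : AlgebraGroup A) : Module.Dual F A :=
  lam ∘ₗ rightMul F g⁻¹

/-- The coadjoint action of `1 + A` on the dual space: `λ^g(X) = λ(g X g⁻¹)`. -/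
noncomputable def coadjoint (lam : Module.Dual F A) (g : AlgebraGroup A) : Module.Dual F A :=
  lam ∘ₗ leftMul F g ∘ₗ rightMul F g⁻¹

/-- The orbit `λH` of `λ` under the right action of the algebra subgroup `H = 1 + B`. -/
def subgroupOrbit (lam : Module.Dual F A) (B : NonUnitalSubalgebra F A) : Set (Module.Dual F A) :=
  Set.range fun h : AlgebraGroup B => rightAct lam (incl B h)

/-- The orbit `λG` of `λ` under the right action of the whole algebra group `G = 1 + A`. -/
def rightOrbit (lam : Module.Dual F A) : Set (Module.Dual F A) := Set.range (rightAct lam)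

/-- The coadjoint orbit `λ^G`. -/
def coadjointOrbit (lam : Module.Dual F A) : Set (Module.Dual F A) := Set.range (coadjoint lam)

/-- `θ_λ(g) = θ(λ(g - 1))`. -/
def thetaFn {F A : Type*} [Field F] [NonUnitalRing A] [Module F A]
    (θ : AddChar F ℂ) (lam : Module.Dual F A) (g : AlgebraGroup A) : ℂ :=
  θ (lam g.val)

/-- The Kirillov function `ψ_λ = |λ^G|^{-1/2} ∑_{ν ∈ λ^G} θ_ν`. -/
noncomputable def kirillov (θ : AddChar F ℂ) (lam : Module.Dual F A) (g : AlgebraGroup A) : ℂ :=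
  ((Real.sqrt (Nat.card (coadjointOrbit lam)) : ℝ) : ℂ)⁻¹ *
    ∑ᶠ ν ∈ coadjointOrbit lam, thetaFn θ ν g

end Actions

open Classical in
/-- Induction to `G = 1 + A` of a function on the algebra subgroup `H = 1 + B`:
`Ind_H^G(f)(g) = |H|⁻¹ ∑ f(x g x⁻¹)`, the sum over the `x ∈ G` with `x g x⁻¹ ∈ H`. -/
noncomputable def ind [IsNilpotentAlgebra A] (B : NonUnitalSubalgebra F A)
    (f : AlgebraGroup B → ℂ) (g : AlgebraGroup A) : ℂ :=
  (Nat.card (AlgebraGroup B) : ℂ)⁻¹ *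
    ∑ᶠ x : AlgebraGroup A, if hx : (x * g * x⁻¹).val ∈ B then f ⟨⟨(x * g * x⁻¹).val, hx⟩⟩ else 0

section Chain

variable [IsScalarTower F A A] [SMulCommClass F A A]

/-- The left kernel `{X ∈ B : λ(XY) = 0 for all Y ∈ B}` of the form `(X, Y) ↦ λ(XY)` on `B × B`. -/
def leftKer (lam : Module.Dual F A) (B : NonUnitalSubalgebra F A) : NonUnitalSubalgebra F A where
  carrier := {X | X ∈ B ∧ ∀ Y ∈ B, lam (X * Y) = 0}
  add_mem' := fun {X X'} hX hX' =>
    ⟨add_mem hX.1 hX'.1, fun Y hY => by rw [add_mul, map_add, hX.2 Y hY, hX'.2 Y hY, add_zero]⟩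
  zero_mem' := ⟨zero_mem B, fun Y _ => by simp⟩
  mul_mem' := fun {X X'} hX hX' =>
    ⟨mul_mem hX.1 hX'.1, fun Y hY => by rw [mul_assoc]; exact hX.2 _ (mul_mem hX'.1 hY)⟩
  smul_mem' := fun c X hX =>
    ⟨B.smul_mem' c hX.1, fun Y hY => by rw [smul_mul_assoc, map_smul, hX.2 Y hY, smul_zero]⟩

/-- The left kernel `{X ∈ B : λ(XY) = 0 for all Y ∈ leftKer λ B}` of the form `(X, Y) ↦ λ(XY)`
on `B × leftKer λ B`. -/
def nextSub (lam : Module.Dual F A) (B : NonUnitalSubalgebra F A) : NonUnitalSubalgebra F A where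
  carrier := {X | X ∈ B ∧ ∀ Y ∈ leftKer lam B, lam (X * Y) = 0}
  add_mem' := fun {X X'} hX hX' =>
    ⟨add_mem hX.1 hX'.1, fun Y hY => by rw [add_mul, map_add, hX.2 Y hY, hX'.2 Y hY, add_zero]⟩
  zero_mem' := ⟨zero_mem B, fun Y _ => by simp⟩
  mul_mem' := fun {X X'} hX hX' =>
    ⟨mul_mem hX.1 hX'.1, fun Y hY => by
      rw [mul_assoc]
      refine hX.2 _ ⟨mul_mem hX'.1 hY.1, fun Z hZ => ?_⟩
      rw [mul_assoc]
      exact hX'.2 _ ⟨mul_mem hY.1 hZ, fun W hW => by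
        rw [mul_assoc]; exact hY.2 _ (mul_mem hZ hW)⟩⟩
  smul_mem' := fun c X hX =>
    ⟨B.smul_mem' c hX.1, fun Y hY => by rw [smul_mul_assoc, map_smul, hX.2 Y hY, smul_zero]⟩

/-- The descending chain `𝔰⁰ = A`,
`𝔰ⁱ⁺¹ = {X ∈ 𝔰ⁱ : λ(XY) = 0 for all Y ∈ 𝔩ⁱ⁺¹}`, where `𝔩ⁱ⁺¹ = leftKer λ 𝔰ⁱ`. -/
def sChain (lam : Module.Dual F A) : ℕ → NonUnitalSubalgebra F A
  | 0 => ⊤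
  | i + 1 => nextSub lam (sChain lam i)

/-- The ascending chain `𝔩⁰ = 0`, `𝔩ⁱ⁺¹ = {X ∈ 𝔰ⁱ : λ(XY) = 0 for all Y ∈ 𝔰ⁱ}`. -/
def lChain (lam : Module.Dual F A) : ℕ → NonUnitalSubalgebra F A
  | 0 => ⊥
  | i + 1 => leftKer lam (sChain lam i)

theorem exists_stable [Module.Finite F A] (lam : Module.Dual F A) :
    ∃ d : ℕ, 1 ≤ d ∧ sChain lam (d - 1) = sChain lam d := by
  let f : ℕ →o (Submodule F A)ᵒᵈ :=
    ⟨fun i => OrderDual.toDual (sChain lam i).toSubmodule,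
      monotone_nat_of_le_succ fun i X (hX : X ∈ nextSub lam (sChain lam i)) => hX.1⟩
  obtain ⟨n, hn⟩ := IsArtinian.monotone_stabilizes (R := F) (M := A) f
  refine ⟨n + 1, by omega, ?_⟩
  have h := hn (n + 1) (by omega)
  exact NonUnitalSubalgebra.toSubmodule_injective (OrderDual.toDual.injective h)

open Classical in
/-- The least `d ≥ 1` with `𝔰ᵈ⁻¹ = 𝔰ᵈ`; both chains are constant from this index on. -/
noncomputable def stableIndex [Module.Finite F A] (lam : Module.Dual F A) : ℕ :=
  Nat.find (exists_stable lam)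

/-- The terminal element `𝔰̄_λ` of the descending chain. -/
noncomputable def sBar [Module.Finite F A] (lam : Module.Dual F A) : NonUnitalSubalgebra F A :=
  sChain lam (stableIndex lam)

/-- The terminal element `𝔩̄_λ` of the ascending chain. -/
noncomputable def lBar [Module.Finite F A] (lam : Module.Dual F A) : NonUnitalSubalgebra F A :=
  lChain lam (stableIndex lam)

/-- `ξ_λ = Ind_{L̄_λ}^G(θ_λ)`, where `L̄_λ = 1 + 𝔩̄_λ`. -/
noncomputable def xi [Module.Finite F A] [IsNilpotentAlgebra A]
    (θ : AddChar F ℂ) (lam : Module.Dual F A) : AlgebraGroup A → ℂ :=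
  ind (lBar lam) (fun h => thetaFn θ lam (incl (lBar lam) h))

end Chain

end AlgebraGroup

/-- The inner product `⟨f, g⟩_G = |G|⁻¹ ∑_{x ∈ G} f(x) conj(g(x))` of functions on a finite
group. -/
noncomputable def groupInner {G : Type*} (f g : G → ℂ) : ℂ :=
  (Nat.card G : ℂ)⁻¹ * ∑ᶠ x : G, f x * (starRingEnd ℂ) (g x)

/-- `f ∈ Irr(G)`: the function `f` is the character of an irreducible finite-dimensional complex
representation of `G`. -/
def IsIrreducibleCharacter {G : Type*} [Group G] (f : G → ℂ) : Prop :=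
  ∃ (n : ℕ) (ρ : Representation ℂ G (Fin n → ℂ)), ρ.IsIrreducible ∧ ρ.character = f

open AlgebraGroup

/-! Write `λ' = λ(·(1+Y))` with `Y ∈ 𝔰̄`. Everything rests on a duality along the chains: a
functional vanishing on `𝔰ⁱ` is `λ(·Z)` with `Z ∈ 𝔩ⁱ` (`exists_mem_lChain_of_forall_sChain`).
Stability makes `𝔩̄` a two-sided ideal of `𝔰̄` that pairs to zero with `𝔰̄` under `λ` on both sides.
The duality then gives two descriptions of `𝔰̄` that hold for every such `λ'`: it is the set of `X`
with `λ'(UX) = λ'(XU)` for all `U ∈ 𝔩̄` (`mem_sBar_of_forall_lBar`), and `x ∈ S̄` exactly when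
`λ'^x` agrees with `λ` on `𝔩̄` (`forall_lBar_coadjoint_eq_iff`).

By the first description, the `L̄`-conjugates of `λ'` are spread evenly over `λ'` plus the
annihilator of `𝔰̄`. Averaging `θ_λ'` over `L̄` therefore cuts it off to `S̄`
(`sum_thetaFn_conj_lBar`), so inducing `ψ_μ'` gives a multiple of `ψ_λ'`. The multiple is 1 by the
orbit count `card_coadjointOrbit_mul_sq`.

By the second description, Frobenius reciprocity gives `⟨ξ_λ, ψ_λ'⟩ = √|μ'^S̄|`, an integer because
the form `μ'(XY - YX)` is alternating and so has even rank.

Kirillov functions have norm one, so each is irreducible as soon as it is a character. Induction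
carries a character `ψ_μ'` up to `ψ_λ'`; the `θ_λ`-isotypic part under `L̄` carries a character
`ψ_λ'` down to `ψ_μ'` (`isotypic_kirillov`). -/

/-! ### Complex representations: norm-one characters and induction -/

open scoped ComplexOrder in
-- Averaging the standard Hermitian form gives an invariant positive definite matrix `H`; it
-- conjugates `M g⁻¹` into the adjoint of `M g`, and traces are compared.
theorem Representation.character_inv_eq_conj {G V : Type*} [Group G] [Finite G] [AddCommGroup V]
    [Module ℂ V] [FiniteDimensional ℂ V] (ρ : Representation ℂ G V) (g : G) :
    ρ.character g⁻¹ = (starRingEnd ℂ) (ρ.character g) := by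
  classical
  have := Fintype.ofFinite G
  let b := Module.finBasis ℂ V
  let M : G → Matrix _ _ ℂ := fun x => LinearMap.toMatrix b b (ρ x)
  have hmul : ∀ x y, M (x * y) = M x * M y := fun x y => by
    simp only [M, map_mul, LinearMap.toMatrix_mul]
  have hone : M 1 = 1 := by simp only [M, map_one]; exact LinearMap.toMatrix_one b
  let H := ∑ x, (M x).conjTranspose * M x
  have hH : H.PosDef := by
    have h : H = (M 1).conjTranspose * M 1 +
        ∑ x ∈ Finset.univ.erase 1, (M x).conjTranspose * M x :=
      (Finset.add_sum_erase _ _ (Finset.mem_univ 1)).symm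
    rw [h, hone, Matrix.conjTranspose_one, one_mul]
    exact Matrix.PosDef.one.add_posSemidef
      (Matrix.posSemidef_sum _ fun x _ => Matrix.posSemidef_conjTranspose_mul_self _)
  have hinv : (M g).conjTranspose * H * M g = H := by
    simp only [H, Finset.mul_sum, Finset.sum_mul]
    refine Fintype.sum_equiv (Equiv.mulRight g) _ _ fun x => ?_
    simp only [Equiv.coe_mulRight, hmul, Matrix.conjTranspose_mul, Matrix.mul_assoc]
  have hgg : M g * M g⁻¹ = 1 := by rw [← hmul, mul_inv_cancel, hone]
  have hdet : IsUnit H.det := hH.isUnit.map Matrix.detMonoidHom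
  have key : M g⁻¹ = H⁻¹ * ((M g).conjTranspose * H) := by
    calc M g⁻¹ = H⁻¹ * (H * M g⁻¹) := by
          rw [← Matrix.mul_assoc, Matrix.nonsing_inv_mul _ hdet, one_mul]
      _ = H⁻¹ * ((M g).conjTranspose * H * M g * M g⁻¹) := by rw [hinv]
      _ = _ := by rw [Matrix.mul_assoc _ (M g), hgg, mul_one]
  have htr : ∀ x, ρ.character x = (M x).trace := fun x =>
    LinearMap.trace_eq_matrix_trace ℂ b (ρ x)
  rw [htr, htr, key, Matrix.trace_mul_comm, Matrix.mul_assoc, Matrix.mul_nonsing_inv _ hdet,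
    mul_one, Matrix.trace_conjTranspose]
  rfl

/-- The norm is the dimension of the endomorphism algebra, so every endomorphism is a scalar. By
Maschke a submodule has a complement, and the projection onto it, being a scalar, forces it to be
zero or everything. -/
theorem Representation.isIrreducible_of_groupInner_character_eq_one {G V : Type*} [Group G]
    [Finite G] [AddCommGroup V] [Module ℂ V] [FiniteDimensional ℂ V] (ρ : Representation ℂ G V)
    (h : groupInner ρ.character ρ.character = 1) : ρ.IsIrreducible := by
  classical
  have := Fintype.ofFinite G
  have hne : (Nat.card G : ℂ) ≠ 0 := Nat.cast_ne_zero.2 Nat.card_pos.ne'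
  have : Invertible (Nat.card G : ℂ) := invertibleOfNonzero hne
  have : NeZero (Nat.card G : ℂ) := ⟨hne⟩
  have h1 : Module.finrank ℂ (IntertwiningMap ρ ρ) = 1 := by
    have h2 := Representation.card_inv_mul_sum_char_mul_char_eq_finrank ρ ρ
    simp only [groupInner, finsum_eq_sum_of_fintype, ← ρ.character_inv_eq_conj] at h
    rw [h] at h2
    exact_mod_cast h2.symm
  have h1' : Module.finrank ℂ (Module.End (MonoidAlgebra ℂ G) ρ.asModule) = 1 := by
    rw [← h1]
    exact (IntertwiningMap.equivAlgEnd (ρ := ρ)).toLinearEquiv.finrank_eq.symm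
  rw [irreducible_iff_isSimpleModule_asModule, isSimpleModule_iff]
  have hnt : Nontrivial (Module.End (MonoidAlgebra ℂ G) ρ.asModule) :=
    Module.nontrivial_of_finrank_eq_succ h1'
  have hnt' : Nontrivial ρ.asModule := by
    by_contra hc
    rw [not_nontrivial_iff_subsingleton] at hc
    exact not_subsingleton (Module.End (MonoidAlgebra ℂ G) ρ.asModule)
      ⟨fun f g => LinearMap.ext fun x => Subsingleton.elim _ _⟩
  have hns : Nontrivial (Submodule (MonoidAlgebra ℂ G) ρ.asModule) :=
    (Submodule.nontrivial_iff _).2 hnt'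
  refine ⟨fun p => ?_⟩
  obtain ⟨q, hpq⟩ := MonoidAlgebra.Submodule.exists_isCompl (k := ℂ) (G := G) p
  let e : Module.End (MonoidAlgebra ℂ G) ρ.asModule := p.subtype ∘ₗ p.projectionOnto q hpq
  obtain ⟨c, hc⟩ := (finrank_eq_one_iff_of_nonzero' (1 : Module.End (MonoidAlgebra ℂ G) ρ.asModule)
    one_ne_zero).1 h1' e
  have he : ∀ x : ρ.asModule, e x = c • x := fun x => by rw [← hc]; rfl
  by_cases hc0 : c = 0
  · left
    rw [eq_bot_iff]
    intro x hx
    have h3 : e x = x := by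
      change ((p.projectionOnto q hpq x : p) : ρ.asModule) = x
      rw [Submodule.projectionOnto_apply_left hpq ⟨x, hx⟩]
    rw [he, hc0, zero_smul] at h3
    exact h3.symm
  · right
    rw [eq_top_iff]
    intro x _
    have h3 : e (c⁻¹ • x) = x := by rw [he, smul_smul, mul_inv_cancel₀ hc0, one_smul]
    rw [← h3]
    exact (p.projectionOnto q hpq _).2

/-- The image of an idempotent `P` commuting with `ρ` affords the character `g ↦ tr (ρ g ∘ P)`. -/
theorem Representation.exists_character_eq_trace_comp {G V : Type*} [Group G]
    [AddCommGroup V] [Module ℂ V] [FiniteDimensional ℂ V] (ρ : Representation ℂ G V)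
    (P : V →ₗ[ℂ] V) (hP : ∀ v, P (P v) = P v) (hcomm : ∀ g v, P (ρ g v) = ρ g (P v)) :
    ∃ (n : ℕ) (σ : Representation ℂ G (Fin n → ℂ)),
      σ.character = fun g => LinearMap.trace ℂ V (ρ g ∘ₗ P) := by
  let U : Subrepresentation ρ :=
    ⟨LinearMap.range P, by rintro g _ ⟨w, rfl⟩; exact ⟨ρ g w, hcomm g w⟩⟩
  let e : U.toSubmodule ≃ₗ[ℂ] (Fin (Module.finrank ℂ U.toSubmodule) → ℂ) :=
    (Module.finBasis ℂ U.toSubmodule).equivFun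
  let τ := U.toRepresentation
  let σ : Representation ℂ G (Fin (Module.finrank ℂ U.toSubmodule) → ℂ) :=
    { toFun := fun g => e.conj (τ g)
      map_one' := by rw [map_one]; exact e.conj_id
      map_mul' := fun g h => by rw [map_mul]; exact e.conj_comp _ _ }
  refine ⟨_, σ, funext fun g => ?_⟩
  change LinearMap.trace ℂ _ (e.conj (τ g)) = _
  have hmem : ∀ v, (ρ g ∘ₗ P) v ∈ U.toSubmodule := fun v => ⟨ρ g v, hcomm g v⟩
  rw [LinearMap.trace_conj', ← LinearMap.trace_restrict_eq_of_forall_mem U.toSubmodule _ hmem]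
  congr 1
  ext ⟨_, w, rfl⟩
  change ρ g (P w) = ρ g (P (P w))
  rw [hP]

theorem LinearMap.trace_pi_comp {X V : Type*} [Fintype X] [DecidableEq X]
    [AddCommGroup V] [Module ℂ V] [FiniteDimensional ℂ V] (a : V →ₗ[ℂ] V) (s : X → X) :
    LinearMap.trace ℂ (X → V) (LinearMap.pi fun x => a ∘ₗ LinearMap.proj (s x)) =
      ∑ x, if s x = x then LinearMap.trace ℂ V a else 0 := by
  classical
  let b := Module.finBasis ℂ V
  rw [LinearMap.trace_eq_matrix_trace ℂ (Pi.basis fun _ : X => b), Matrix.trace, Fintype.sum_sigma]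
  refine Finset.sum_congr rfl fun x _ => ?_
  rw [LinearMap.trace_eq_matrix_trace ℂ b, Matrix.trace]
  split_ifs with hx
  · refine Finset.sum_congr rfl fun i _ => ?_
    simp [Matrix.diag, LinearMap.toMatrix_apply, hx]
  · refine Finset.sum_eq_zero fun i _ => ?_
    simp [Matrix.diag, LinearMap.toMatrix_apply, Pi.single_eq_of_ne hx]

open Classical in
/-- The induced representation, realized as the image of an averaging idempotent on `G → V`. -/
theorem Representation.exists_character_eq_induced {G H V : Type*} [Group G] [Fintype G] [Group H]
    [Fintype H] [AddCommGroup V] [Module ℂ V] [FiniteDimensional ℂ V] (φ : H →* G)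
    (ρ : Representation ℂ H V) :
    ∃ (n : ℕ) (σ : Representation ℂ G (Fin n → ℂ)), σ.character = fun g =>
      (Nat.card H : ℂ)⁻¹ * ∑ x : G, ∑ h : H, if φ h = x * g * x⁻¹ then ρ.character h else 0 := by
  have hne : (Nat.card H : ℂ) ≠ 0 := Nat.cast_ne_zero.2 Nat.card_pos.ne'
  -- `π` is right translation on functions. `Q` below sums the twisted left translations, and `|H|⁻¹
  -- Q` projects onto the functions with `f (φ h * x) = ρ h (f x)`.
  let π : Representation ℂ G (G → V) :=
    { toFun := fun g => LinearMap.pi fun x => LinearMap.proj (x * g)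
      map_one' := by ext; simp
      map_mul' := fun g h => by
        apply LinearMap.ext; intro f; funext x; simp [mul_assoc] }
  have hπ : ∀ g f x, π g f x = f (x * g) := fun _ _ _ => rfl
  let Q : (G → V) →ₗ[ℂ] (G → V) :=
    ∑ h : H, LinearMap.pi fun x => ρ h⁻¹ ∘ₗ LinearMap.proj (φ h * x)
  have hQ : ∀ f x, Q f x = ∑ h : H, ρ h⁻¹ (f (φ h * x)) := fun f x => by
    simp [Q, LinearMap.sum_apply, Finset.sum_apply]
  have hQinv : ∀ f k x, ρ k⁻¹ (Q f (φ k * x)) = Q f x := fun f k x => by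
    rw [hQ, hQ, map_sum]
    refine Fintype.sum_equiv (Equiv.mulRight k) _ _ fun h => ?_
    simp only [Equiv.coe_mulRight, mul_inv_rev, map_mul, Module.End.mul_apply, mul_assoc]
  let P : (G → V) →ₗ[ℂ] (G → V) := (Nat.card H : ℂ)⁻¹ • Q
  obtain ⟨n, σ, hσ⟩ := π.exists_character_eq_trace_comp P
    (fun f => by
      funext x
      simp only [P, LinearMap.smul_apply, map_smul, Pi.smul_apply]
      rw [hQ (Q f)]
      simp only [hQinv]
      rw [Finset.sum_const, Finset.card_univ, ← Nat.card_eq_fintype_card, ← Nat.cast_smul_eq_nsmul ℂ,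
        inv_smul_smul₀ hne])
    (fun g f => by
      funext x
      simp only [P, LinearMap.smul_apply, map_smul, Pi.smul_apply]
      simp only [hQ, hπ, mul_assoc])
  refine ⟨n, σ, hσ.trans (funext fun g => ?_)⟩
  have hcomp : π g ∘ₗ P = (Nat.card H : ℂ)⁻¹ •
      ∑ h : H, LinearMap.pi fun x => ρ h⁻¹ ∘ₗ LinearMap.proj (φ h * (x * g)) := by
    apply LinearMap.ext; intro f; funext x
    simp only [P, LinearMap.comp_apply, LinearMap.smul_apply, Pi.smul_apply, hπ, hQ]
    simp [LinearMap.sum_apply, Finset.sum_apply]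
  rw [hcomp, map_smul, map_sum, smul_eq_mul, Finset.sum_comm]
  congr 1
  -- A diagonal block survives when `φ h * (x * g) = x`, that is `φ h⁻¹ = x * g * x⁻¹`; hence the
  -- substitution `h ↦ h⁻¹`.
  refine Fintype.sum_equiv (Equiv.inv H) _ _ fun h => ?_
  rw [LinearMap.trace_pi_comp]
  refine Finset.sum_congr rfl fun x _ => ?_
  refine if_congr ?_ rfl rfl
  rw [Equiv.inv_apply, map_inv, inv_eq_iff_mul_eq_one, ← mul_assoc _ (x * g), mul_inv_eq_one]

/-! ### Counting by fibres, duality and additive characters -/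

theorem sum_comp_eq_of_card_fiber {Z V : Type*} [Fintype Z] [DecidableEq V] {c : Z → V} {k : ℕ}
    (hc : ∀ z, Nat.card {z' // c z' = c z} = k) (f : V → ℂ) :
    ∑ z, f (c z) = k * ∑ v ∈ Finset.univ.image c, f v := by
  rw [Finset.sum_comp f c, Finset.mul_sum]
  refine Finset.sum_congr rfl fun v hv => ?_
  obtain ⟨z, -, rfl⟩ := Finset.mem_image.1 hv
  rw [← hc z, Nat.card_eq_fintype_card, Fintype.card_subtype, nsmul_eq_mul]

/-- Two maps with all fibres of the same size `k`, defined on sets of the same size, and the first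
of which takes values in the range of the second, are equidistributed. -/
theorem sum_comp_eq_sum_comp_of_card_fiber {X Y V : Type*} [Fintype X] [Fintype Y] [DecidableEq V]
    {a : X → V} {b : Y → V} {k : ℕ} (ha : ∀ x, Nat.card {x' // a x' = a x} = k)
    (hb : ∀ y, Nat.card {y' // b y' = b y} = k) (hsub : ∀ x, ∃ y, b y = a x)
    (hcard : Fintype.card X = Fintype.card Y) (f : V → ℂ) :
    ∑ x, f (a x) = ∑ y, f (b y) := by
  rw [sum_comp_eq_of_card_fiber ha, sum_comp_eq_of_card_fiber hb]
  have hA := sum_comp_eq_of_card_fiber ha fun _ => 1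
  have hB := sum_comp_eq_of_card_fiber hb fun _ => 1
  simp only [Finset.sum_const, Finset.card_univ, nsmul_eq_mul, mul_one] at hA hB
  rcases Nat.eq_zero_or_pos k with rfl | hk
  · simp
  · congr 2
    -- The image of `a` lies in that of `b`, and each has `|X| / k = |Y| / k` elements.
    refine Finset.eq_of_subset_of_card_le (fun v hv => ?_) ?_
    · obtain ⟨x, -, rfl⟩ := Finset.mem_image.1 hv
      obtain ⟨y, hy⟩ := hsub x
      exact Finset.mem_image.2 ⟨y, Finset.mem_univ _, hy⟩
    · rw [hcard, hB] at hA
      have hA' : k * (Finset.univ.image b).card = k * (Finset.univ.image a).card := by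
        exact_mod_cast hA
      exact (Nat.eq_of_mul_eq_mul_left hk hA').le

/-- In finite dimension, a functional that vanishes on the common kernel of a family of functionals
depending linearly on a parameter belongs to the family. -/
theorem exists_eq_of_forall_eq_zero {F M N : Type*} [Field F] [AddCommGroup M] [Module F M]
    [AddCommGroup N] [Module F N] [Module.Finite F N] (b : M →ₗ[F] Module.Dual F N)
    (η : Module.Dual F N) (h : ∀ n, (∀ m, b m n = 0) → η n = 0) : ∃ m, b m = η := by
  have h1 : η ∈ (LinearMap.range b).dualCoannihilator.dualAnnihilator := by
    rw [Submodule.mem_dualAnnihilator]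
    intro n hn
    rw [Submodule.mem_dualCoannihilator] at hn
    exact h n fun m => hn _ ⟨m, rfl⟩
  rwa [Subspace.dualCoannihilator_dualAnnihilator_eq] at h1

open Classical in
-- A nonzero functional is onto `F`, so its composite with `θ` is a nontrivial additive character,
-- whose values sum to zero.
theorem sum_addChar_comp_dual {F M : Type*} [Field F] [AddCommGroup M] [Module F M] [Fintype M]
    {θ : AddChar F ℂ} (hθ : θ ≠ 1) (η : Module.Dual F M) :
    ∑ X, θ (η X) = if η = 0 then (Fintype.card M : ℂ) else 0 := by
  let ψ : AddChar M ℂ := θ.compAddMonoidHom η.toAddMonoidHom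
  have h : ∀ X, θ (η X) = ψ X := fun _ => rfl
  have h0 : ψ = 0 ↔ η = 0 := by
    constructor
    · intro hψ
      by_contra hη
      refine hθ (DFunLike.ext _ _ fun c => ?_)
      obtain ⟨X, hX⟩ := LinearMap.surjective hη c
      rw [← hX, h, hψ]
      simp
    · rintro rfl
      ext X
      simp [← h]
  simp only [h, AddChar.sum_eq_ite, h0]

/-! ### Algebra groups and their actions on the dual -/

namespace AlgebraGroup

section Basic

/-- The bijection `1 + X ↦ X`. -/
def valEquiv (A : Type*) : AlgebraGroup A ≃ A := ⟨val, mk, fun _ => rfl, fun _ => rfl⟩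

@[simp] theorem valEquiv_apply {A : Type*} (g : AlgebraGroup A) : valEquiv A g = g.val := rfl

variable {F A : Type*} [Field F] [NonUnitalRing A] [Module F A]

theorem res_apply (lam : Module.Dual F A) (B : NonUnitalSubalgebra F A) (X : B) :
    res lam B X = lam X := rfl

theorem leftMul_apply [SMulCommClass F A A] (g : AlgebraGroup A) (X : A) :
    leftMul F g X = X + g.val * X := rfl

theorem rightMul_apply [IsScalarTower F A A] (g : AlgebraGroup A) (X : A) :
    rightMul F g X = X + X * g.val := rfl

theorem leftMul_mul [SMulCommClass F A A] (g h : AlgebraGroup A) (X : A) :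
    leftMul F (g * h) X = leftMul F g (leftMul F h X) := by
  simp only [leftMul_apply, val_mul, add_mul, mul_add, mul_assoc]; abel

theorem rightMul_mul [IsScalarTower F A A] (g h : AlgebraGroup A) (X : A) :
    rightMul F (g * h) X = rightMul F h (rightMul F g X) := by
  simp only [rightMul_apply, val_mul, add_mul, mul_add, mul_assoc]; abel

theorem leftMul_one [SMulCommClass F A A] (X : A) : leftMul F (1 : AlgebraGroup A) X = X := by
  simp [leftMul_apply]

theorem rightMul_one [IsScalarTower F A A] (X : A) : rightMul F (1 : AlgebraGroup A) X = X := by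
  simp [rightMul_apply]

theorem rightMul_mem [IsScalarTower F A A] {B : NonUnitalSubalgebra F A} {g : AlgebraGroup A}
    (hg : g.val ∈ B) {X : A} (hX : X ∈ B) : rightMul F g X ∈ B := add_mem hX (mul_mem hX hg)

section Nilpotent

variable [IsNilpotentAlgebra A]

theorem val_inv_add (g : AlgebraGroup A) : g.val + g⁻¹.val + g.val * g⁻¹.val = 0 := by
  rw [← val_mul, mul_inv_cancel, val_one]

theorem val_inv_add' (g : AlgebraGroup A) : g⁻¹.val + g.val + g⁻¹.val * g.val = 0 := by
  rw [← val_mul, inv_mul_cancel, val_one]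

theorem rightMul_inv_rightMul [IsScalarTower F A A] (g : AlgebraGroup A) (X : A) :
    rightMul F g⁻¹ (rightMul F g X) = X := by
  rw [← rightMul_mul, mul_inv_cancel, rightMul_one]

theorem rightMul_rightMul_inv [IsScalarTower F A A] (g : AlgebraGroup A) (X : A) :
    rightMul F g (rightMul F g⁻¹ X) = X := by
  rw [← rightMul_mul, inv_mul_cancel, rightMul_one]

theorem incl_val (B : NonUnitalSubalgebra F A) (h : AlgebraGroup B) :
    (incl B h).val = (h.val : A) := rfl

theorem incl_injective (B : NonUnitalSubalgebra F A) : Function.Injective (incl B) := by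
  intro g h e
  exact AlgebraGroup.ext (Subtype.ext (congrArg val e))

theorem exists_incl_eq {B : NonUnitalSubalgebra F A} {g : AlgebraGroup A} (hg : g.val ∈ B) :
    ∃ h, incl B h = g := ⟨⟨⟨g.val, hg⟩⟩, rfl⟩

theorem thetaFn_res (θ : AddChar F ℂ) (lam : Module.Dual F A) (B : NonUnitalSubalgebra F A)
    (h : AlgebraGroup B) : thetaFn θ (res lam B) h = thetaFn θ lam (incl B h) := rfl

theorem mem_rightOrbit_iff [IsScalarTower F A A] {lam ν : Module.Dual F A} :
    ν ∈ rightOrbit lam ↔ ∃ Y, ∀ X, ν X = lam X + lam (X * Y) := by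
  constructor
  · rintro ⟨g, rfl⟩
    exact ⟨g⁻¹.val, fun X => map_add lam _ _⟩
  · rintro ⟨Y, h⟩
    refine ⟨(⟨Y⟩ : AlgebraGroup A)⁻¹, LinearMap.ext fun X => ?_⟩
    rw [rightAct, inv_inv, h]
    exact map_add lam _ _

/-- With `1 + Y` the inverse of the acting element, the action becomes free of inverses. This is the
form in which `λ' ∈ λS̄` is used throughout. -/
theorem mem_subgroupOrbit_iff [IsScalarTower F A A] {lam ν : Module.Dual F A}
    {B : NonUnitalSubalgebra F A} :
    ν ∈ subgroupOrbit lam B ↔ ∃ Y ∈ B, ∀ X, ν X = lam X + lam (X * Y) := by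
  constructor
  · rintro ⟨g, rfl⟩
    refine ⟨g⁻¹.val, g⁻¹.val.2, fun X => ?_⟩
    change lam (rightMul F (incl B g)⁻¹ X) = _
    rw [← map_inv, rightMul_apply, map_add]
    rfl
  · rintro ⟨Y, hY, h⟩
    refine ⟨(⟨⟨Y, hY⟩⟩ : AlgebraGroup B)⁻¹, LinearMap.ext fun X => ?_⟩
    simp only [rightAct]
    rw [map_inv, inv_inv, h]
    exact map_add lam _ _

theorem inv_val_mem {B : NonUnitalSubalgebra F A} {g : AlgebraGroup A} (hg : g.val ∈ B) :
    g⁻¹.val ∈ B := by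
  obtain ⟨h, rfl⟩ := exists_incl_eq hg
  rw [← map_inv]
  exact h⁻¹.val.2

end Nilpotent

variable [IsScalarTower F A A] [SMulCommClass F A A]

theorem leftMul_rightMul (g h : AlgebraGroup A) (X : A) :
    leftMul F g (rightMul F h X) = rightMul F h (leftMul F g X) := by
  simp only [leftMul_apply, rightMul_apply, add_mul, mul_add, mul_assoc]; abel

variable [IsNilpotentAlgebra A]

theorem coadjoint_apply (lam : Module.Dual F A) (g : AlgebraGroup A) (X : A) :
    coadjoint lam g X = lam (leftMul F g (rightMul F g⁻¹ X)) := rfl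

theorem coadjoint_apply_rightMul (lam : Module.Dual F A) (g : AlgebraGroup A) (X : A) :
    coadjoint lam g (rightMul F g X) = lam (leftMul F g X) := by
  rw [coadjoint_apply, rightMul_inv_rightMul]

theorem coadjoint_one (lam : Module.Dual F A) : coadjoint lam 1 = lam := by
  ext X
  rw [coadjoint_apply, inv_one, rightMul_one, leftMul_one]

theorem coadjoint_mul (lam : Module.Dual F A) (g h : AlgebraGroup A) :
    coadjoint lam (g * h) = coadjoint (coadjoint lam g) h := by
  ext X
  simp only [coadjoint_apply]
  rw [mul_inv_rev, rightMul_mul, leftMul_mul, leftMul_rightMul]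

/-- Replacing `X` by `Xg` clears the inverse. The stabilizer is thus cut out by linear conditions on
`g - 1`, so orbit sizes are ranks in disguise. -/
theorem coadjoint_eq_self_iff (lam : Module.Dual F A) (g : AlgebraGroup A) :
    coadjoint lam g = lam ↔ ∀ X, lam (g.val * X) = lam (X * g.val) := by
  constructor
  · intro h X
    have h1 := coadjoint_apply_rightMul lam g X
    rw [h, rightMul_apply, leftMul_apply, map_add, map_add] at h1
    exact (add_left_cancel h1).symm
  · intro h
    ext X
    rw [← rightMul_rightMul_inv (F := F) g X, coadjoint_apply_rightMul]
    generalize rightMul F g⁻¹ X = Z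
    rw [rightMul_apply, leftMul_apply, map_add, map_add, h]

theorem coadjoint_eq_coadjoint_iff (lam : Module.Dual F A) (g h : AlgebraGroup A) :
    coadjoint lam g = coadjoint lam h ↔ coadjoint lam (g * h⁻¹) = lam := by
  rw [coadjoint_mul]
  constructor
  · intro e
    rw [e, ← coadjoint_mul, mul_inv_cancel, coadjoint_one]
  · intro e
    rw [← coadjoint_one (coadjoint lam g), ← inv_mul_cancel h, coadjoint_mul, e]

theorem val_conj (x g : AlgebraGroup A) :
    (x * g * x⁻¹).val = leftMul F x (rightMul F x⁻¹ g.val) := by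
  have h : (x * g * x⁻¹).val =
      (x.val + x⁻¹.val + x.val * x⁻¹.val) + leftMul F x (rightMul F x⁻¹ g.val) := by
    simp only [leftMul_apply, rightMul_apply, val_mul, mul_add, mul_assoc]; abel
  rw [h, val_inv_add, zero_add]

theorem thetaFn_conj (θ : AddChar F ℂ) (lam : Module.Dual F A) (x g : AlgebraGroup A) :
    thetaFn θ lam (x * g * x⁻¹) = thetaFn θ (coadjoint lam x) g := by
  rw [thetaFn, thetaFn, val_conj (F := F), coadjoint_apply]

theorem coadjoint_res (lam : Module.Dual F A) (B : NonUnitalSubalgebra F A) (h : AlgebraGroup B) :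
    coadjoint (res lam B) h = res (coadjoint lam (incl B h)) B := by
  ext X
  simp only [coadjoint_apply, res_apply, ← map_inv]
  rfl

/-- Fibres of an orbit map are cosets of the stabilizer. The homomorphism `φ` allows both the whole
group and the subgroup `L̄`. -/
theorem card_coadjoint_fiber {H : Type*} [Group H] (φ : H →* AlgebraGroup A)
    (lam : Module.Dual F A) (h : H) :
    Nat.card {h' // coadjoint lam (φ h') = coadjoint lam (φ h)} =
      Nat.card {h' // coadjoint lam (φ h') = lam} := by
  refine Nat.card_congr ((Equiv.mulRight h⁻¹).subtypeEquiv fun h' => ?_)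
  rw [coadjoint_eq_coadjoint_iff, Equiv.coe_mulRight, map_mul, map_inv]

end Basic

/-! ### Kirillov functions as averages over the group -/

section Kirillov

variable {F A : Type*} [Field F] [NonUnitalRing A] [Module F A]
  [IsScalarTower F A A] [SMulCommClass F A A] [IsNilpotentAlgebra A]
  [Fintype (AlgebraGroup A)]

theorem coadjointOrbit_eq_coe_image [DecidableEq (Module.Dual F A)] (lam : Module.Dual F A) :
    coadjointOrbit lam = ((Finset.univ.image (coadjoint lam) : Finset _) : Set _) := by
  rw [coadjointOrbit, ← Set.image_univ, ← Finset.coe_univ, ← Finset.coe_image]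

theorem sum_coadjoint (lam : Module.Dual F A)
    (f : Module.Dual F A → ℂ) : ∑ x, f (coadjoint lam x) =
      Nat.card {x // coadjoint lam x = lam} * ∑ᶠ ν ∈ coadjointOrbit lam, f ν := by
  classical
  have hfib : ∀ x, Nat.card {x' // coadjoint lam x' = coadjoint lam x} =
    Nat.card {x // coadjoint lam x = lam} := card_coadjoint_fiber (MonoidHom.id _) lam
  rw [sum_comp_eq_of_card_fiber hfib f, coadjointOrbit_eq_coe_image, finsum_mem_coe_finset]

theorem card_coadjointOrbit_mul (lam : Module.Dual F A) :
    Nat.card (coadjointOrbit lam) * Nat.card {x // coadjoint lam x = lam} =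
      Fintype.card (AlgebraGroup A) := by
  classical
  have h := sum_coadjoint lam fun _ => 1
  rw [coadjointOrbit_eq_coe_image, finsum_mem_coe_finset, Finset.sum_const, Finset.sum_const,
    nsmul_eq_mul, nsmul_eq_mul, mul_one, mul_one, mul_comm] at h
  rw [coadjointOrbit_eq_coe_image, Nat.card_coe_set_eq, Set.ncard_coe_finset, ← Finset.card_univ]
  exact_mod_cast h.symm

theorem card_coadjointOrbit_pos (lam : Module.Dual F A) : 0 < Nat.card (coadjointOrbit lam) := by
  have h := card_coadjointOrbit_mul lam
  exact Nat.pos_of_ne_zero fun h0 => by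
    rw [h0, zero_mul] at h
    exact Fintype.card_ne_zero h.symm

theorem finsum_mem_coadjointOrbit (lam : Module.Dual F A) (f : Module.Dual F A → ℂ) :
    ∑ᶠ ν ∈ coadjointOrbit lam, f ν =
      Nat.card (coadjointOrbit lam) * (Fintype.card (AlgebraGroup A) : ℂ)⁻¹ *
        ∑ x, f (coadjoint lam x) := by
  have hne : (Fintype.card (AlgebraGroup A) : ℂ) ≠ 0 := Nat.cast_ne_zero.2 Fintype.card_ne_zero
  rw [sum_coadjoint, ← mul_assoc, mul_right_comm (Nat.card (coadjointOrbit lam) : ℂ),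
    ← Nat.cast_mul, card_coadjointOrbit_mul, mul_inv_cancel₀ hne, one_mul]

/-- `ψ_λ` is a multiple of the average of the conjugates of `θ_λ`. -/
theorem kirillov_eq_sum (θ : AddChar F ℂ) (lam : Module.Dual F A) (g : AlgebraGroup A) :
    kirillov θ lam g = (Real.sqrt (Nat.card (coadjointOrbit lam)) : ℂ) *
      (Fintype.card (AlgebraGroup A) : ℂ)⁻¹ * ∑ x, thetaFn θ (coadjoint lam x) g := by
  rw [kirillov, finsum_mem_coadjointOrbit]
  have h : (Real.sqrt (Nat.card (coadjointOrbit lam)) : ℂ) ≠ 0 := by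
    rw [Complex.ofReal_ne_zero, Real.sqrt_ne_zero']
    exact_mod_cast card_coadjointOrbit_pos lam
  have h2 : (Nat.card (coadjointOrbit lam) : ℂ) = (Real.sqrt (Nat.card (coadjointOrbit lam)) : ℂ) *
      (Real.sqrt (Nat.card (coadjointOrbit lam)) : ℂ) := by
    rw [← Complex.ofReal_mul, Real.mul_self_sqrt (Nat.cast_nonneg _), Complex.ofReal_natCast]
  rw [← mul_assoc, ← mul_assoc, h2, ← mul_assoc, inv_mul_cancel₀ h, one_mul]

end Kirillov

set_option linter.unusedSectionVars false

/-! ### The chains, their terminal elements and the duality -/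

section Chain

variable {F A : Type*} [Field F] [NonUnitalRing A] [Module F A]
  [IsScalarTower F A A] [SMulCommClass F A A]

theorem leftKer_le (lam : Module.Dual F A) (B : NonUnitalSubalgebra F A) : leftKer lam B ≤ B :=
  fun _ hX => hX.1

theorem nextSub_le (lam : Module.Dual F A) (B : NonUnitalSubalgebra F A) : nextSub lam B ≤ B :=
  fun _ hX => hX.1

theorem leftKer_le_nextSub (lam : Module.Dual F A) (B : NonUnitalSubalgebra F A) :
    leftKer lam B ≤ nextSub lam B :=
  fun _ hX => ⟨hX.1, fun Y hY => hX.2 Y hY.1⟩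

theorem leftKer_le_leftKer_nextSub (lam : Module.Dual F A) (B : NonUnitalSubalgebra F A) :
    leftKer lam B ≤ leftKer lam (nextSub lam B) :=
  fun _ hX => ⟨leftKer_le_nextSub lam B hX, fun Y hY => hX.2 Y hY.1⟩

theorem mul_mem_leftKer {lam : Module.Dual F A} {B : NonUnitalSubalgebra F A} {X Y : A}
    (hX : X ∈ leftKer lam B) (hY : Y ∈ B) : X * Y ∈ leftKer lam B :=
  ⟨mul_mem hX.1 hY, fun Z hZ => by rw [mul_assoc]; exact hX.2 _ (mul_mem hY hZ)⟩

theorem sChain_antitone (lam : Module.Dual F A) : Antitone (sChain lam) :=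
  antitone_nat_of_succ_le fun i => nextSub_le lam (sChain lam i)

theorem lChain_monotone (lam : Module.Dual F A) : Monotone (lChain lam) :=
  monotone_nat_of_le_succ fun i => by
    cases i with
    | zero => exact bot_le
    | succ i => exact leftKer_le_leftKer_nextSub lam (sChain lam i)

theorem sChain_eq_of_stable {lam : Module.Dual F A} {d : ℕ} (h : sChain lam (d + 1) = sChain lam d)
    (j : ℕ) : sChain lam (d + j) = sChain lam d := by
  induction j with
  | zero => rfl
  | succ j ih =>
    change nextSub lam (sChain lam (d + j)) = _
    rw [ih]
    exact h

/-- The pairing `(Y, X) ↦ λ(XY)` between two subspaces, as a family of functionals of `X`. -/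
def mulPairing (lam : Module.Dual F A) (M N : Submodule F A) : M →ₗ[F] Module.Dual F N :=
  LinearMap.mk₂ F (fun Y X => lam ((X : A) * (Y : A)))
    (fun Y Y' X => by rw [Submodule.coe_add, mul_add, map_add])
    (fun c Y X => by rw [Submodule.coe_smul, mul_smul_comm, map_smul])
    (fun Y X X' => by rw [Submodule.coe_add, add_mul, map_add])
    (fun c Y X => by rw [Submodule.coe_smul, smul_mul_assoc, map_smul])

variable [Module.Finite F A]

theorem exists_stableIndex_eq (lam : Module.Dual F A) :
    ∃ d, stableIndex lam = d + 1 ∧ sChain lam (d + 1) = sChain lam d := by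
  classical
  obtain ⟨h1, h2⟩ := Nat.find_spec (exists_stable lam)
  obtain ⟨d, hd⟩ := Nat.exists_eq_add_of_le' h1
  refine ⟨d, hd, ?_⟩
  rw [hd, Nat.add_sub_cancel] at h2
  exact h2.symm

/-- At the stable index `d + 1`, `𝔩̄` is the left kernel on `𝔰ᵈ`, one step back, and `𝔰ᵈ = 𝔰̄`. -/
theorem lBar_eq_leftKer (lam : Module.Dual F A) : lBar lam = leftKer lam (sBar lam) := by
  obtain ⟨d, hd, h⟩ := exists_stableIndex_eq lam
  rw [lBar, sBar, hd, h]
  rfl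

theorem sBar_le_sChain (lam : Module.Dual F A) (i : ℕ) : sBar lam ≤ sChain lam i := by
  obtain ⟨d, hd, h⟩ := exists_stableIndex_eq lam
  rw [sBar, hd, h, ← sChain_eq_of_stable h i]
  exact sChain_antitone lam (Nat.le_add_left i d)

theorem nextSub_sBar (lam : Module.Dual F A) : nextSub lam (sBar lam) = sBar lam := by
  refine le_antisymm (nextSub_le _ _) ?_
  exact sBar_le_sChain lam (stableIndex lam + 1)

theorem lChain_le_lBar (lam : Module.Dual F A) (i : ℕ) : lChain lam i ≤ lBar lam := by
  obtain ⟨d, hd, h⟩ := exists_stableIndex_eq lam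
  have h1 : lChain lam (d + i + 1) = lBar lam := by
    rw [lBar, hd]
    change leftKer lam (sChain lam (d + i)) = leftKer lam (sChain lam d)
    rw [sChain_eq_of_stable h]
  rw [← h1]
  exact lChain_monotone lam (by omega)

theorem lBar_le_sBar (lam : Module.Dual F A) : lBar lam ≤ sBar lam := by
  rw [lBar_eq_leftKer]
  exact leftKer_le _ _

theorem apply_lBar_mul_sBar {lam : Module.Dual F A} {X Y : A} (hX : X ∈ lBar lam)
    (hY : Y ∈ sBar lam) : lam (X * Y) = 0 := by
  rw [lBar_eq_leftKer] at hX
  exact hX.2 Y hY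

/-- Stability `nextSub lam (sBar lam) = sBar lam` turns the left kernel into a two-sided one. -/
theorem apply_sBar_mul_lBar {lam : Module.Dual F A} {X Y : A} (hX : X ∈ sBar lam)
    (hY : Y ∈ lBar lam) : lam (X * Y) = 0 := by
  rw [← nextSub_sBar] at hX
  rw [lBar_eq_leftKer] at hY
  exact hX.2 Y hY

theorem mul_mem_lBar_right {lam : Module.Dual F A} {X Y : A} (hX : X ∈ lBar lam)
    (hY : Y ∈ sBar lam) : X * Y ∈ lBar lam := by
  rw [lBar_eq_leftKer] at hX ⊢
  exact mul_mem_leftKer hX hY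

/-- Together with `mul_mem_lBar_right`, this makes `𝔩̄` a two-sided ideal of `𝔰̄`, and so `L̄`
normal in `S̄`. -/
theorem mul_mem_lBar_left {lam : Module.Dual F A} {X U : A} (hX : X ∈ sBar lam) (hU : U ∈ lBar lam) :
    X * U ∈ lBar lam := by
  have h : X * U ∈ leftKer lam (sBar lam) := ⟨mul_mem hX (lBar_le_sBar lam hU), fun Z hZ => by
    rw [mul_assoc]
    exact apply_sBar_mul_lBar hX (mul_mem_lBar_right hU hZ)⟩
  rwa [← lBar_eq_leftKer] at h

/-- Every functional vanishing on `𝔰ⁱ` is of the form `X ↦ λ(XY)` with `Y ∈ 𝔩ⁱ`. -/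
theorem exists_mem_lChain_of_forall_sChain (lam : Module.Dual F A) (i : ℕ) (η : Module.Dual F A)
    (hη : ∀ X ∈ sChain lam i, η X = 0) : ∃ Y ∈ lChain lam i, ∀ X, η X = lam (X * Y) := by
  induction i generalizing η with
  | zero => exact ⟨0, zero_mem _, fun X => by rw [hη X trivial, mul_zero, map_zero]⟩
  | succ i ih =>
    -- Inside `𝔰ⁱ`, the common kernel of the functionals `λ(·Y)` with `Y ∈ 𝔩ⁱ⁺¹` is `𝔰ⁱ⁺¹`, where
    -- `η` vanishes. So `η` is one of them on `𝔰ⁱ`, and the difference is left to the induction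
    -- hypothesis.
    obtain ⟨⟨Y, hY⟩, hYη⟩ := exists_eq_of_forall_eq_zero
      (mulPairing lam (lChain lam (i + 1)).toSubmodule (sChain lam i).toSubmodule)
      (η ∘ₗ (sChain lam i).toSubmodule.subtype)
      (fun X hX => hη X ⟨X.2, fun Y hY => hX ⟨Y, hY⟩⟩)
    let ζ : Module.Dual F A := lam ∘ₗ LinearMap.mulRight F Y
    obtain ⟨Z, hZ, hZη⟩ := ih (η - ζ) (fun X hX => by
      have h := LinearMap.congr_fun hYη ⟨X, hX⟩
      exact sub_eq_zero.2 h.symm)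
    refine ⟨Z + Y, add_mem (lChain_monotone lam (Nat.le_succ i) hZ) hY, fun X => ?_⟩
    rw [mul_add, map_add, ← hZη]
    exact (sub_add_cancel _ _).symm

theorem exists_mem_lBar_of_forall_sBar (lam : Module.Dual F A) (η : Module.Dual F A)
    (hη : ∀ X ∈ sBar lam, η X = 0) : ∃ Y ∈ lBar lam, ∀ X, η X = lam (X * Y) :=
  exists_mem_lChain_of_forall_sChain lam _ η hη

/-- A functional that is of the form `X ↦ λ(X(1 + Y))` with `Y ∈ 𝔰̄` on `𝔰̄` is so on the whole
algebra. -/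
theorem exists_mem_sBar_of_forall_sBar {lam ν : Module.Dual F A} {Y : A} (hY : Y ∈ sBar lam)
    (h : ∀ X ∈ sBar lam, ν X = lam X + lam (X * Y)) :
    ∃ Z ∈ sBar lam, ∀ X, ν X = lam X + lam (X * Z) := by
  obtain ⟨Z, hZ, hZη⟩ := exists_mem_lBar_of_forall_sBar lam
    (ν - lam - lam ∘ₗ LinearMap.mulRight F Y) (fun X hX => by
      change ν X - lam X - lam (X * Y) = 0
      rw [h X hX]
      abel)
  refine ⟨Z + Y, add_mem (lBar_le_sBar lam hZ) hY, fun X => ?_⟩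
  have h1 : ν X - lam X - lam (X * Y) = lam (X * Z) := hZη X
  rw [mul_add, map_add, ← h1]
  abel

/-- A functional agreeing with `λ` on `𝔩̄` is of the form `X ↦ λ(X(1 + Y))` with `Y ∈ 𝔰̄`. -/
theorem exists_mem_sBar_of_forall_lBar {lam ν : Module.Dual F A}
    (hν : ∀ X ∈ lBar lam, ν X = lam X) :
    ∃ Y ∈ sBar lam, ∀ X, ν X = lam X + lam (X * Y) := by
  -- `ν - λ` vanishes on the left kernel `𝔩̄` of the form on `𝔰̄`, so it is represented on `𝔰̄` by
  -- some `Y ∈ 𝔰̄`.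
  obtain ⟨⟨Y, hY⟩, hYη⟩ := exists_eq_of_forall_eq_zero
    (mulPairing lam (sBar lam).toSubmodule (sBar lam).toSubmodule)
    ((ν - lam) ∘ₗ (sBar lam).toSubmodule.subtype)
    (fun X hX => sub_eq_zero.2 (hν X (by
      rw [lBar_eq_leftKer]
      exact ⟨X.2, fun Y hY => hX ⟨Y, hY⟩⟩)))
  refine exists_mem_sBar_of_forall_sBar hY fun X hX => ?_
  have h : lam (X * Y) = ν X - lam X := LinearMap.congr_fun hYη ⟨X, hX⟩
  rw [h]
  abel

variable [IsNilpotentAlgebra A]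

theorem res_mem_rightOrbit_iff (lam lam' : Module.Dual F A) :
    res lam' (sBar lam) ∈ rightOrbit (res lam (sBar lam)) ↔
      lam' ∈ subgroupOrbit lam (sBar lam) := by
  rw [mem_rightOrbit_iff, mem_subgroupOrbit_iff]
  constructor
  · rintro ⟨Y, h⟩
    exact exists_mem_sBar_of_forall_sBar Y.2 fun X hX => h ⟨X, hX⟩
  · rintro ⟨Y, hY, h⟩
    exact ⟨⟨Y, hY⟩, fun X => h X⟩

/-- If `X ∈ 𝔰ⁱ` and `λ(XU(1 + Y)) = 0` for all `U ∈ 𝔩ⁱ⁺¹`, where `Y ∈ 𝔰̄`, then `X ∈ 𝔰ⁱ⁺¹`. -/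
theorem mem_sChain_succ_of_forall {lam : Module.Dual F A} {Y : A} (hY : Y ∈ sBar lam) {i : ℕ}
    {X : A} (hX : X ∈ sChain lam i)
    (h : ∀ U ∈ lChain lam (i + 1), lam (X * U) + lam (X * U * Y) = 0) :
    X ∈ sChain lam (i + 1) := by
  refine ⟨hX, fun V hV => ?_⟩
  let y : AlgebraGroup (sBar lam) := ⟨⟨Y, hY⟩⟩
  have hy : (y⁻¹.val : A) + Y + (y⁻¹.val : A) * Y = 0 := congrArg Subtype.val (val_inv_add' y)
  -- Testing on `U = V(1 + Y)⁻¹` cancels the factor `1 + Y`; `U` stays in `𝔩ⁱ⁺¹`, which is a right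
  -- ideal of `𝔰ⁱ`.
  have hU : V + V * (y⁻¹.val : A) ∈ lChain lam (i + 1) :=
    add_mem hV (mul_mem_leftKer hV (sBar_le_sChain lam i y⁻¹.val.2))
  have h1 := h _ hU
  rw [← map_add] at h1
  have h2 : X * (V + V * (y⁻¹.val : A)) + X * (V + V * (y⁻¹.val : A)) * Y =
      X * V + X * (V * ((y⁻¹.val : A) + Y + (y⁻¹.val : A) * Y)) := by
    simp only [mul_add, add_mul, mul_assoc]; abel
  rwa [h2, hy, mul_zero, mul_zero, add_zero] at h1

/-- Descent along the chain: for `X ∈ 𝔰ⁱ` and `U ∈ 𝔩ⁱ⁺¹` one has `λ'(UX) = 0`, so the symmetry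
forces `λ'(XU) = 0`, which puts `X` in `𝔰ⁱ⁺¹`. -/
theorem mem_sBar_of_forall_lBar {lam lam' : Module.Dual F A} {Y : A} (hY : Y ∈ sBar lam)
    (h' : ∀ X, lam' X = lam X + lam (X * Y)) {X : A}
    (hX : ∀ U ∈ lBar lam, lam' (U * X) = lam' (X * U)) : X ∈ sBar lam := by
  have key : ∀ i, X ∈ sChain lam i := by
    intro i
    induction i with
    | zero => trivial
    | succ i ih =>
      refine mem_sChain_succ_of_forall hY ih fun U hU => ?_
      rw [← h', ← hX U (lChain_le_lBar lam _ hU), h', mul_assoc, hU.2 X ih,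
        hU.2 _ (mul_mem ih (sBar_le_sChain lam i hY)), add_zero]
  exact key _

/-- By duality `λ'^x = λ(·(1 + Z))` with `Z ∈ 𝔰̄`. Suppose `x - 1 ∈ 𝔰ⁱ` and evaluate at `Ux` with `U
∈ 𝔩ⁱ⁺¹`: one side collapses to `λ(U)`, the other is `λ'(xU) = λ(U) + λ'((x - 1)U)`. Hence `λ'((x -
1)U) = 0` and `x - 1 ∈ 𝔰ⁱ⁺¹`. -/
theorem val_mem_sBar_of_coadjoint {lam lam' : Module.Dual F A} {Y : A} (hY : Y ∈ sBar lam)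
    (h' : ∀ X, lam' X = lam X + lam (X * Y)) {x : AlgebraGroup A}
    (hx : ∀ X ∈ lBar lam, coadjoint lam' x X = lam X) : x.val ∈ sBar lam := by
  obtain ⟨Z, hZ, hν⟩ := exists_mem_sBar_of_forall_lBar hx
  have key : ∀ i, x.val ∈ sChain lam i := by
    intro i
    induction i with
    | zero => trivial
    | succ i ih =>
      refine mem_sChain_succ_of_forall hY ih fun U hU => ?_
      have hUl := lChain_le_lBar lam _ hU
      have h1 := coadjoint_apply_rightMul lam' x U
      have hZi := sBar_le_sChain lam i hZ
      rw [hν, leftMul_apply, map_add, rightMul_apply, map_add, add_mul, map_add, mul_assoc,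
        hU.2 _ ih, hU.2 _ hZi, hU.2 _ (mul_mem ih hZi), h', h', apply_lBar_mul_sBar hUl hY] at h1
      simpa using h1.symm
  exact key _

theorem apply_eq_of_mem_lBar {lam lam' : Module.Dual F A} {Y : A} (hY : Y ∈ sBar lam)
    (h' : ∀ X, lam' X = lam X + lam (X * Y)) {X : A} (hX : X ∈ lBar lam) : lam' X = lam X := by
  rw [h', apply_lBar_mul_sBar hX hY, add_zero]

theorem apply_lBar_mul_sBar' {lam lam' : Module.Dual F A} {Y : A} (hY : Y ∈ sBar lam)
    (h' : ∀ X, lam' X = lam X + lam (X * Y)) {U X : A} (hU : U ∈ lBar lam) (hX : X ∈ sBar lam) :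
    lam' (U * X) = 0 := by
  rw [h', mul_assoc, apply_lBar_mul_sBar hU hX, apply_lBar_mul_sBar hU (mul_mem hX hY), add_zero]

theorem apply_sBar_mul_lBar' {lam lam' : Module.Dual F A} {Y : A} (hY : Y ∈ sBar lam)
    (h' : ∀ X, lam' X = lam X + lam (X * Y)) {U X : A} (hU : U ∈ lBar lam) (hX : X ∈ sBar lam) :
    lam' (X * U) = 0 := by
  rw [h', mul_assoc, apply_sBar_mul_lBar hX hU,
    apply_sBar_mul_lBar hX (mul_mem_lBar_right hU hY), add_zero]

/-- Elements of `1 + 𝔩̄` do not change the restriction to `𝔰̄`. -/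
theorem coadjoint_apply_of_val_mem_lBar {lam lam' : Module.Dual F A} {Y : A} (hY : Y ∈ sBar lam)
    (h' : ∀ X, lam' X = lam X + lam (X * Y)) {h : AlgebraGroup A} (hh : h.val ∈ lBar lam) {X : A}
    (hX : X ∈ sBar lam) : coadjoint lam' h X = lam' X := by
  have hZ : rightMul F h⁻¹ X ∈ sBar lam := rightMul_mem (inv_val_mem (lBar_le_sBar lam hh)) hX
  rw [← rightMul_rightMul_inv (F := F) h X, coadjoint_apply_rightMul]
  generalize rightMul F h⁻¹ X = Z at hZ
  rw [leftMul_apply, rightMul_apply, map_add, map_add, apply_lBar_mul_sBar' hY h' hh hZ,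
    apply_sBar_mul_lBar' hY h' hh hZ]

/-- Elements of `1 + 𝔰̄` do not change the restriction to `𝔩̄`. -/
theorem coadjoint_apply_of_val_mem_sBar {lam lam' : Module.Dual F A} {Y : A} (hY : Y ∈ sBar lam)
    (h' : ∀ X, lam' X = lam X + lam (X * Y)) {h : AlgebraGroup A} (hh : h.val ∈ sBar lam) {X : A}
    (hX : X ∈ lBar lam) : coadjoint lam' h X = lam X := by
  have hZ : rightMul F h⁻¹ X ∈ lBar lam :=
    add_mem hX (mul_mem_lBar_right hX (inv_val_mem hh))
  rw [← apply_eq_of_mem_lBar hY h' hX, ← rightMul_rightMul_inv (F := F) h X,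
    coadjoint_apply_rightMul]
  generalize rightMul F h⁻¹ X = Z at hZ
  rw [leftMul_apply, rightMul_apply, map_add, map_add, apply_lBar_mul_sBar' hY h' hZ hh,
    apply_sBar_mul_lBar' hY h' hZ hh]

/-- The functionals in the coadjoint orbit of `λ' ∈ λS̄` that agree with `λ` on `𝔩̄` are those
obtained from `λ'` by elements of `S̄`. -/
theorem forall_lBar_coadjoint_eq_iff {lam lam' : Module.Dual F A} {Y : A} (hY : Y ∈ sBar lam)
    (h' : ∀ X, lam' X = lam X + lam (X * Y)) {x : AlgebraGroup A} :
    (∀ X ∈ lBar lam, coadjoint lam' x X = lam X) ↔ x.val ∈ sBar lam :=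
  ⟨val_mem_sBar_of_coadjoint hY h', fun hx _ hX => coadjoint_apply_of_val_mem_sBar hY h' hx hX⟩

end Chain

end AlgebraGroup

/-! ### Commutator forms and orbit sizes -/

/-- An alternating form has even rank. -/
theorem exists_finrank_eq_finrank_ker_add_two_mul {F V : Type*} [Field F] [AddCommGroup V]
    [Module F V] [Module.Finite F V] (b : V →ₗ[F] Module.Dual F V) (hb : ∀ x, b x x = 0) :
    ∃ k, Module.finrank F V = Module.finrank F (LinearMap.ker b) + 2 * k := by
  have hskew : ∀ x y, b x y = -b y x := fun x y => by
    have h := hb (x + y)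
    simp only [map_add, LinearMap.add_apply, hb, zero_add, add_zero] at h
    exact eq_neg_of_add_eq_zero_right h
  -- A maximal totally isotropic subspace `W` is its own orthogonal. Then `dim V = dim b(W) + dim W`
  -- and `dim W = dim b(W) + dim ker b`, so `k = dim b(W)`.
  obtain ⟨W, hW, hmax⟩ : ∃ W : Submodule F V, (∀ x ∈ W, ∀ y ∈ W, b x y = 0) ∧
      ∀ W' : Submodule F V, (∀ x ∈ W', ∀ y ∈ W', b x y = 0) → W ≤ W' → W' = W := by
    obtain ⟨W, hW, hmax⟩ := (wellFounded_gt (α := Submodule F V)).has_min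
      {W : Submodule F V | ∀ x ∈ W, ∀ y ∈ W, b x y = 0} ⟨⊥, by simp⟩
    exact ⟨W, hW, fun W' h h' => (eq_of_le_of_not_lt h' (hmax W' h)).symm⟩
  have hperp : ∀ x, (∀ y ∈ W, b y x = 0) → x ∈ W := by
    intro x hx
    rw [← hmax (W ⊔ F ∙ x) ?_ le_sup_left]
    · exact Submodule.mem_sup_right (Submodule.mem_span_singleton_self x)
    · intro u hu v hv
      obtain ⟨w, hw, _, hc, rfl⟩ := Submodule.mem_sup.1 hu
      obtain ⟨w', hw', _, hc', rfl⟩ := Submodule.mem_sup.1 hv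
      obtain ⟨c, rfl⟩ := Submodule.mem_span_singleton.1 hc
      obtain ⟨c', rfl⟩ := Submodule.mem_span_singleton.1 hc'
      simp [hW w hw w' hw', hx w hw, hskew x w', hx w' hw', hb x]
  have hker : LinearMap.ker b ≤ W := fun x hx => hperp x fun y _ => by
    rw [hskew, LinearMap.mem_ker.1 hx, LinearMap.zero_apply, neg_zero]
  have hco : (W.map b).dualCoannihilator = W := by
    ext x
    rw [Submodule.mem_dualCoannihilator]
    constructor
    · intro h
      exact hperp x fun y hy => h _ (Submodule.mem_map_of_mem hy)
    · rintro hx _ ⟨y, hy, rfl⟩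
      exact hW y hy x hx
  have h1 := Subspace.finrank_add_finrank_dualCoannihilator_eq (W.map b)
  rw [hco] at h1
  have h2 := LinearMap.finrank_range_add_finrank_ker (b.domRestrict W)
  rw [LinearMap.range_domRestrict, LinearMap.ker_domRestrict,
    (Submodule.comapSubtypeEquivOfLe hker).finrank_eq] at h2
  exact ⟨Module.finrank F (W.map b), by omega⟩

namespace AlgebraGroup

section Comm

variable {F A : Type*} [Field F] [NonUnitalRing A] [Module F A]
  [IsScalarTower F A A] [SMulCommClass F A A]

/-- The pairing `(U, X) ↦ λ(UX - XU)` between a subspace and `A`. -/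
def commPairing (lam : Module.Dual F A) (M : Submodule F A) : M →ₗ[F] Module.Dual F A :=
  LinearMap.mk₂ F (fun U X => lam ((U : A) * X - X * (U : A)))
    (fun Y Y' X => by rw [Submodule.coe_add, mul_add, add_mul, ← map_add]; congr 1; abel)
    (fun c Y X => by rw [Submodule.coe_smul, mul_smul_comm, smul_mul_assoc, ← smul_sub, map_smul])
    (fun Y X X' => by rw [mul_add, add_mul, ← map_add]; congr 1; abel)
    (fun c Y X => by rw [mul_smul_comm, smul_mul_assoc, ← smul_sub, map_smul])

theorem commPairing_apply (lam : Module.Dual F A) (M : Submodule F A) (U : M) (X : A) :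
    commPairing lam M U X = lam ((U : A) * X) - lam (X * (U : A)) := map_sub lam _ _

theorem commPairing_eq_zero_iff (lam : Module.Dual F A) (M : Submodule F A) (U : M) :
    commPairing lam M U = 0 ↔ ∀ X, lam ((U : A) * X) = lam (X * (U : A)) := by
  simp only [LinearMap.ext_iff, commPairing_apply, sub_eq_zero, LinearMap.zero_apply]

/-- The stabilizer is the radical of the alternating form `λ(XY - YX)`, so the orbit has `q` to the
rank of this form elements, and the rank is even. -/
theorem exists_card_coadjointOrbit_eq_sq [Finite F] [Module.Finite F A] [IsNilpotentAlgebra A]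
    (lam : Module.Dual F A) : ∃ m : ℕ, 0 < m ∧ Nat.card (coadjointOrbit lam) = m * m := by
  have : Finite A := Module.finite_of_finite F
  have : Fintype (AlgebraGroup A) := @Fintype.ofFinite _ (Finite.of_equiv A (valEquiv A).symm)
  obtain ⟨k, hk⟩ := exists_finrank_eq_finrank_ker_add_two_mul
    (commPairing lam ⊤ ∘ₗ (Submodule.topEquiv (R := F) (M := A)).symm.toLinearMap)
    (fun x => by
      rw [LinearMap.comp_apply, commPairing_apply]
      exact sub_self _)
  have h := card_coadjointOrbit_mul lam
  generalize hc : commPairing lam ⊤ ∘ₗ (Submodule.topEquiv (R := F) (M := A)).symm.toLinearMap = c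
    at hk
  have hker : Nat.card {x // coadjoint lam x = lam} = Nat.card (LinearMap.ker c) := by
    subst hc
    refine Nat.card_congr ((valEquiv A).subtypeEquiv fun x => ?_)
    rw [coadjoint_eq_self_iff]
    exact (commPairing_eq_zero_iff lam ⊤ ⟨x.val, trivial⟩).symm
  rw [hker, ← Nat.card_eq_fintype_card, Nat.card_congr (valEquiv A),
    Module.natCard_eq_pow_finrank (K := F) (V := A), hk,
    Module.natCard_eq_pow_finrank (K := F) (V := LinearMap.ker c), pow_add, mul_comm] at h
  have hq : 0 < Nat.card F := Nat.card_pos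
  refine ⟨Nat.card F ^ k, pow_pos hq _, ?_⟩
  rw [← pow_add, ← two_mul]
  exact Nat.eq_of_mul_eq_mul_left (pow_pos hq _) h

end Comm

/-! ### Averaging over `L̄`, and comparison of orbits -/

section Sums

variable {F A : Type*} [Field F] [NonUnitalRing A] [Module F A]
  [IsScalarTower F A A] [SMulCommClass F A A] [Module.Finite F A] [IsNilpotentAlgebra A]

open Classical in
/-- Averaging `θ_{λ'}` over conjugation by `L̄` truncates it to `S̄`. -/
theorem sum_thetaFn_conj_lBar {θ : AddChar F ℂ} (hθ : θ ≠ 1) {lam lam' : Module.Dual F A}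
    [Fintype (AlgebraGroup (lBar lam))] {Y : A} (hY : Y ∈ sBar lam)
    (h' : ∀ X, lam' X = lam X + lam (X * Y)) (y : AlgebraGroup A) :
    ∑ k, thetaFn θ lam' (incl (lBar lam) k * y * (incl (lBar lam) k)⁻¹) =
      if y.val ∈ sBar lam then
        (Fintype.card (AlgebraGroup (lBar lam)) : ℂ) * thetaFn θ lam' y else 0 := by
  let M := (lBar lam).toSubmodule
  let D := commPairing lam' M
  let e : AlgebraGroup (lBar lam) ≃ M := valEquiv (lBar lam)
  have : Fintype M := Fintype.ofEquiv _ e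
  simp only [thetaFn_conj]
  have hzero : ∀ X ∈ sBar lam, ∀ U, D U X = 0 := fun X hX U => by
    rw [commPairing_apply, apply_lBar_mul_sBar' hY h' U.2 hX, apply_sBar_mul_lBar' hY h' U.2 hX,
      sub_zero]
  have hmem : ∀ X, (∀ U, D U X = 0) → X ∈ sBar lam := fun X hX =>
    mem_sBar_of_forall_lBar hY h' fun U hU => by
      have h := hX ⟨U, hU⟩
      rwa [commPairing_apply, sub_eq_zero] at h
  -- The conjugates `λ'^k` and the translates `λ' + D U` have fibres of the same size, `|ker D|`.
  -- Moreover `λ'^k - λ'` vanishes on `𝔰̄`, the common kernel of the `D U`, so it is some `D U`. The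
  -- nonlinear sum is thus replaced by a linear one.
  have hsum := sum_comp_eq_sum_comp_of_card_fiber (a := fun k => coadjoint lam' (incl (lBar lam) k))
    (b := fun U => lam' + D U) (k := Nat.card {U // D U = 0})
    (fun k => by
      rw [card_coadjoint_fiber]
      refine Nat.card_congr (e.subtypeEquiv fun k => ?_)
      rw [coadjoint_eq_self_iff, commPairing_eq_zero_iff]
      rfl)
    (fun U => Nat.card_congr ((Equiv.subRight U).subtypeEquiv fun U' => by
      rw [Equiv.subRight_apply, map_sub, sub_eq_zero, add_right_inj]))
    (fun k => by
      obtain ⟨U, hU⟩ := exists_eq_of_forall_eq_zero D (coadjoint lam' (incl (lBar lam) k) - lam')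
        (fun X hX => sub_eq_zero.2
          (coadjoint_apply_of_val_mem_lBar hY h' k.val.2 (hmem X hX)))
      exact ⟨U, by rw [hU]; abel⟩)
    (Fintype.card_congr e) (fun ν => thetaFn θ ν y)
  rw [hsum]
  have hterm : ∀ U, thetaFn θ (lam' + D U) y = thetaFn θ lam' y * θ (D.flip y.val U) := fun U => by
    rw [thetaFn, LinearMap.add_apply, AddChar.map_add_eq_mul]
    rfl
  simp only [hterm]
  rw [← Finset.mul_sum, sum_addChar_comp_dual hθ, Fintype.card_congr e]
  have hiff : D.flip y.val = 0 ↔ y.val ∈ sBar lam :=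
    ⟨fun h => hmem _ fun U => LinearMap.congr_fun h U, fun h => LinearMap.ext fun U => hzero _ h U⟩
  simp only [hiff]
  split_ifs
  · rw [mul_comm]
  · rw [mul_zero]

/-- The orbits of `λ'` and of its restriction to `𝔰̄` satisfy `|λ'^G| |S̄|² = |μ'^S̄| |G|²`. -/
theorem card_coadjointOrbit_mul_sq [Finite F] {lam lam' : Module.Dual F A}
    [Fintype (AlgebraGroup A)] [Fintype (AlgebraGroup (sBar lam))]
    {Y : A} (hY : Y ∈ sBar lam) (h' : ∀ X, lam' X = lam X + lam (X * Y)) :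
    Nat.card (coadjointOrbit lam') * Fintype.card (AlgebraGroup (sBar lam)) ^ 2 =
      Nat.card (coadjointOrbit (res lam' (sBar lam))) * Fintype.card (AlgebraGroup A) ^ 2 := by
  let S := (sBar lam).toSubmodule
  let D := commPairing lam' S
  -- `R` is the radical of the commutator form of `μ'`, hence the stabilizer of `μ'`, and contains
  -- `𝔩̄`. The map `f : R → 𝔰̄^⊥` is onto because the common kernel of the `D U` with `U ∈ R` lies
  -- in `𝔰̄`; its kernel is the stabilizer of `λ'`. So the two stabilizers differ by the factor
  -- `|𝔰̄^⊥| = |G| / |S̄|`.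
  let R := S.dualAnnihilator.comap D
  let f : R →ₗ[F] S.dualAnnihilator := D.restrict fun _ h => h
  have hlR : ∀ U (hU : U ∈ lBar lam), (⟨U, lBar_le_sBar lam hU⟩ : S) ∈ R := fun U hU => by
    rw [Submodule.mem_comap, Submodule.mem_dualAnnihilator]
    intro X hX
    rw [commPairing_apply]
    rw [apply_lBar_mul_sBar' hY h' hU hX, apply_sBar_mul_lBar' hY h' hU hX, sub_zero]
  have hmem : ∀ X, (∀ U ∈ R, D U X = 0) → X ∈ sBar lam := fun X hX =>
    mem_sBar_of_forall_lBar hY h' fun U hU => by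
      have h := hX _ (hlR U hU)
      rwa [commPairing_apply, sub_eq_zero] at h
  have hsurj : LinearMap.range f = ⊤ := LinearMap.range_eq_top.2 fun η => by
    obtain ⟨U, hU⟩ := exists_eq_of_forall_eq_zero (D.domRestrict R) η.1 fun X hX =>
      (Submodule.mem_dualAnnihilator _).1 η.2 X (hmem X fun U hU => hX ⟨U, hU⟩)
    exact ⟨U, Subtype.ext hU⟩
  have hrank := LinearMap.finrank_range_add_finrank_ker (V := R) (V₂ := S.dualAnnihilator) f
  rw [hsurj, finrank_top] at hrank
  have hann := Subspace.finrank_add_finrank_dualAnnihilator_eq S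
  have hst : Nat.card {x // coadjoint lam' x = lam'} = Nat.card (LinearMap.ker f) := by
    symm
    refine Nat.card_congr (Equiv.ofBijective (fun U => ⟨⟨((U : R) : S)⟩, ?_⟩) ⟨?_, ?_⟩)
    · rw [coadjoint_eq_self_iff]
      exact (commPairing_eq_zero_iff lam' S _).1 (congrArg Subtype.val (LinearMap.mem_ker.1 U.2))
    · intro U V h
      exact Subtype.ext (Subtype.ext (Subtype.ext (congrArg (fun x => x.1.val) h)))
    · rintro ⟨x, hx⟩
      rw [coadjoint_eq_self_iff] at hx
      have hxs : x.val ∈ S := mem_sBar_of_forall_lBar hY h' fun U _ => (hx U).symm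
      have hD : D ⟨x.val, hxs⟩ = 0 := (commPairing_eq_zero_iff lam' S _).2 hx
      exact ⟨⟨⟨⟨x.val, hxs⟩, by
        change D ⟨x.val, hxs⟩ ∈ S.dualAnnihilator
        rw [hD]
        exact zero_mem _⟩, Subtype.ext hD⟩, rfl⟩
  have hst' : Nat.card {x // coadjoint (res lam' (sBar lam)) x = res lam' (sBar lam)} =
      Nat.card R := by
    refine Nat.card_congr ((valEquiv (sBar lam)).subtypeEquiv fun x => ?_)
    rw [coadjoint_eq_self_iff]
    change _ ↔ D x.val ∈ S.dualAnnihilator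
    rw [Submodule.mem_dualAnnihilator]
    refine ⟨fun h X hX => ?_, fun h X => ?_⟩
    · rw [commPairing_apply, sub_eq_zero]
      exact h ⟨X, hX⟩
    · have h1 := h X X.2
      rwa [commPairing_apply, sub_eq_zero] at h1
  have hA := card_coadjointOrbit_mul lam'
  have hS := card_coadjointOrbit_mul (res lam' (sBar lam))
  have hcA : Fintype.card (AlgebraGroup A) = Nat.card F ^ Module.finrank F A := by
    rw [← Nat.card_eq_fintype_card, Nat.card_congr (valEquiv A),
      Module.natCard_eq_pow_finrank (K := F)]
  have hcS : Fintype.card (AlgebraGroup (sBar lam)) = Nat.card F ^ Module.finrank F S := by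
    rw [← Nat.card_eq_fintype_card, Nat.card_congr (valEquiv (sBar lam))]
    exact Module.natCard_eq_pow_finrank (K := F) (V := S)
  rw [hst, Module.natCard_eq_pow_finrank (K := F) (V := LinearMap.ker f), hcA] at hA
  rw [hst', Module.natCard_eq_pow_finrank (K := F) (V := R), hcS, ← hrank] at hS
  rw [hcA, hcS]
  have hq : 0 < Nat.card F := Nat.card_pos
  refine Nat.eq_of_mul_eq_mul_right (pow_pos hq (Module.finrank F (LinearMap.ker f))) ?_
  calc _ = (Nat.card (coadjointOrbit lam') * Nat.card F ^ Module.finrank F (LinearMap.ker f)) *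
        (Nat.card F ^ Module.finrank F S) ^ 2 := by ring
    _ = (Nat.card (coadjointOrbit (res lam' (sBar lam))) * Nat.card F ^
        (Module.finrank F S.dualAnnihilator + Module.finrank F (LinearMap.ker f))) *
        (Nat.card F ^ Module.finrank F A * Nat.card F ^ Module.finrank F S) := by
      rw [hA, hS]; ring
    _ = _ := by rw [← hann]; ring

end Sums

end AlgebraGroup

/-! ### Isotypic parts, Frobenius reciprocity and norms -/

theorem isIrreducibleCharacter_of_groupInner {G : Type*} [Group G] [Finite G] {f : G → ℂ}
    (hf : ∃ (n : ℕ) (σ : Representation ℂ G (Fin n → ℂ)), σ.character = f)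
    (h : groupInner f f = 1) : IsIrreducibleCharacter f := by
  obtain ⟨n, σ, rfl⟩ := hf
  exact ⟨n, σ, σ.isIrreducible_of_groupInner_character_eq_one h, rfl⟩

/-- The `χ`-isotypic part of a representation of `G` under a subgroup `L`, as a representation of a
group `S` that normalizes `L` and fixes `χ`. -/
theorem Representation.exists_character_eq_isotypic {G L S V : Type*} [Group G] [Group L]
    [Fintype L] [Group S] [AddCommGroup V] [Module ℂ V] [FiniteDimensional ℂ V]
    (i : L →* G) (hi : Function.Injective i) (j : S →* G) (ρ : Representation ℂ G V) (χ : L →* ℂ)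
    (hc : ∀ s, ∃ c : L → L, ∀ k, i (c k) = j s * i k * (j s)⁻¹ ∧ χ (c k) = χ k) :
    ∃ (n : ℕ) (σ : Representation ℂ S (Fin n → ℂ)), σ.character = fun s =>
      (Fintype.card L : ℂ)⁻¹ * ∑ k, χ k⁻¹ * ρ.character (j s * i k) := by
  have hne : (Fintype.card L : ℂ) ≠ 0 := Nat.cast_ne_zero.2 Fintype.card_ne_zero
  -- `|L|⁻¹ Q` is the projector onto the `χ`-isotypic part; it commutes with `S` because conjugation
  -- by `S` permutes `L` and preserves `χ`.
  let Q : V →ₗ[ℂ] V := ∑ k, χ k⁻¹ • ρ (i k)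
  have hQ : ∀ v, Q v = ∑ k, χ k⁻¹ • ρ (i k) v := fun v => by simp [Q, LinearMap.sum_apply]
  have hχ : ∀ k, χ k * χ k⁻¹ = 1 := fun k => by rw [← map_mul, mul_inv_cancel, map_one]
  have hQL : ∀ k v, χ k⁻¹ • ρ (i k) (Q v) = Q v := fun k v => by
    rw [hQ, map_sum, Finset.smul_sum]
    refine Fintype.sum_equiv (Equiv.mulLeft k) _ _ fun k' => ?_
    rw [Equiv.coe_mulLeft, map_smul, smul_smul, mul_inv_rev, map_mul, map_mul, map_mul,
      mul_comm (χ k⁻¹)]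
    rfl
  have hQS : ∀ s v, Q (ρ (j s) v) = ρ (j s) (Q v) := fun s v => by
    obtain ⟨c, hc⟩ := hc s
    have hinj : Function.Injective c := fun k k' h => hi <| by
      have h1 := (hc k).1
      rw [h, (hc k').1] at h1
      exact (mul_left_cancel (mul_right_cancel h1)).symm
    rw [hQ, hQ, map_sum]
    symm
    refine Fintype.sum_bijective c (Finite.injective_iff_bijective.1 hinj) _ _ fun k => ?_
    have h2 : χ (c k)⁻¹ = χ k⁻¹ := by
      have h3 := hχ (c k)
      rw [(hc k).2] at h3
      have hk : χ k ≠ 0 := left_ne_zero_of_mul_eq_one (hχ k)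
      exact mul_left_cancel₀ hk (h3.trans (hχ k).symm)
    rw [h2, map_smul, (hc k).1, ← Module.End.mul_apply, ← map_mul, ← Module.End.mul_apply, ← map_mul,
      inv_mul_cancel_right]
  obtain ⟨n, σ, hσ⟩ := Representation.exists_character_eq_trace_comp (ρ.comp j)
    ((Fintype.card L : ℂ)⁻¹ • Q)
    (fun v => by
      simp only [LinearMap.smul_apply, map_smul]
      rw [hQ (Q v)]
      simp only [hQL]
      rw [Finset.sum_const, Finset.card_univ, ← Nat.cast_smul_eq_nsmul ℂ, inv_smul_smul₀ hne])
    (fun s v => by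
      simp only [LinearMap.smul_apply, MonoidHom.comp_apply, map_smul]
      rw [hQS])
  refine ⟨n, σ, hσ.trans (funext fun s => ?_)⟩
  rw [LinearMap.comp_smul, map_smul, smul_eq_mul]
  congr 1
  have h1 : (ρ.comp j) s ∘ₗ Q = ∑ k, χ k⁻¹ • ρ (j s * i k) := by
    refine LinearMap.ext fun v => ?_
    rw [LinearMap.comp_apply, hQ, map_sum, LinearMap.sum_apply]
    refine Finset.sum_congr rfl fun k _ => ?_
    rw [map_smul, map_mul]
    rfl
  rw [h1, map_sum]
  refine Finset.sum_congr rfl fun k _ => ?_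
  rw [map_smul, smul_eq_mul]
  rfl

namespace AlgebraGroup

open Classical in
-- Through `g ↦ g - 1` the `θ_ν` are additive characters of `A`, distinct for distinct `ν`.
theorem sum_thetaFn_mul_conj {F A : Type*} [Field F] [NonUnitalRing A] [Module F A]
    [Fintype (AlgebraGroup A)] [Finite F] {θ : AddChar F ℂ} (hθ : θ ≠ 1) (ν ν' : Module.Dual F A) :
    ∑ g, thetaFn θ ν g * (starRingEnd ℂ) (thetaFn θ ν' g) =
      if ν = ν' then (Fintype.card (AlgebraGroup A) : ℂ) else 0 := by
  have : Fintype A := Fintype.ofEquiv _ (valEquiv A)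
  have h1 : ∀ g, thetaFn θ ν g * (starRingEnd ℂ) (thetaFn θ ν' g) = θ ((ν - ν') g.val) := fun g => by
    rw [thetaFn, thetaFn, ← AddChar.map_neg_eq_conj, ← AddChar.map_add_eq_mul,
      LinearMap.sub_apply, sub_eq_add_neg]
  simp only [h1]
  rw [show ∑ g : AlgebraGroup A, θ ((ν - ν') g.val) = ∑ X : A, θ ((ν - ν') X) from
      (valEquiv A).sum_comp fun X => θ ((ν - ν') X), sum_addChar_comp_dual hθ,
    Fintype.card_congr (valEquiv A)]
  simp only [sub_eq_zero]
  congr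

section General

variable {F A : Type*} [Field F] [NonUnitalRing A] [Module F A] [IsNilpotentAlgebra A]

open Classical in
theorem sum_ite_incl_eq (B : NonUnitalSubalgebra F A) [Fintype (AlgebraGroup B)]
    (f : AlgebraGroup B → ℂ) (y : AlgebraGroup A) :
    (∑ h, if incl B h = y then f h else 0) =
      if hy : y.val ∈ B then f ⟨⟨y.val, hy⟩⟩ else 0 := by
  split_ifs with hy
  · have h1 : ∀ h, incl B h = y ↔ h = ⟨⟨y.val, hy⟩⟩ := fun h =>
      ⟨fun e => incl_injective B e, fun e => by rw [e]; rfl⟩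
    simp only [h1, Finset.sum_ite_eq', Finset.mem_univ, if_true]
  · refine Finset.sum_eq_zero fun h _ => if_neg ?_
    rintro rfl
    exact hy h.val.2

variable [Fintype (AlgebraGroup A)]

open Classical in
theorem ind_eq_sum (B : NonUnitalSubalgebra F A) [Fintype (AlgebraGroup B)]
    (f : AlgebraGroup B → ℂ) (g : AlgebraGroup A) :
    ind B f g = (Fintype.card (AlgebraGroup B) : ℂ)⁻¹ *
      ∑ x, ∑ h, if incl B h = x * g * x⁻¹ then f h else 0 := by
  rw [ind, Nat.card_eq_fintype_card, finsum_eq_sum_of_fintype]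
  simp only [sum_ite_incl_eq]

open Classical in
theorem sum_ite_mem (B : NonUnitalSubalgebra F A) [Fintype (AlgebraGroup B)]
    (f : AlgebraGroup A → ℂ) :
    (∑ x, if x.val ∈ B then f x else 0) = ∑ h, f (incl B h) := by
  have h1 : ∀ x : AlgebraGroup A, (if x.val ∈ B then f x else 0) =
      ∑ h, if incl B h = x then f (incl B h) else 0 := fun x => by
    rw [sum_ite_incl_eq B (fun h => f (incl B h)) x]
    split_ifs <;> rfl
  simp only [h1]
  rw [Finset.sum_comm]
  refine Finset.sum_congr rfl fun h _ => ?_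
  rw [Finset.sum_ite_eq, if_pos (Finset.mem_univ _)]

/-- Frobenius reciprocity. -/
theorem groupInner_ind (B : NonUnitalSubalgebra F A) [Fintype (AlgebraGroup B)]
    (f : AlgebraGroup B → ℂ) (ψ : AlgebraGroup A → ℂ) (hψ : ∀ x g, ψ (x * g * x⁻¹) = ψ g) :
    groupInner (ind B f) ψ = groupInner f (fun h => ψ (incl B h)) := by
  classical
  have hne : (Fintype.card (AlgebraGroup A) : ℂ) ≠ 0 := Nat.cast_ne_zero.2 Fintype.card_ne_zero
  simp only [groupInner, finsum_eq_sum_of_fintype, Nat.card_eq_fintype_card, ind_eq_sum]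
  have h1 : ∀ x h, (∑ g, if incl B h = x * g * x⁻¹ then f h * (starRingEnd ℂ) (ψ g) else 0) =
      f h * (starRingEnd ℂ) (ψ (incl B h)) := by
    intro x h
    rw [Finset.sum_eq_single (x⁻¹ * incl B h * x)]
    · rw [if_pos (by group), ← hψ x (x⁻¹ * incl B h * x)]
      congr 3
      group
    · intro g _ hg
      refine if_neg fun e => hg ?_
      rw [e]
      group
    · exact fun h => absurd (Finset.mem_univ _) h
  have h2 : ∑ g, ((Fintype.card (AlgebraGroup B) : ℂ)⁻¹ *
      ∑ x, ∑ h, if incl B h = x * g * x⁻¹ then f h else 0) * (starRingEnd ℂ) (ψ g) =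
      (Fintype.card (AlgebraGroup B) : ℂ)⁻¹ * ∑ x : AlgebraGroup A, ∑ h,
        f h * (starRingEnd ℂ) (ψ (incl B h)) := by
    simp only [mul_assoc (Fintype.card (AlgebraGroup B) : ℂ)⁻¹]
    rw [← Finset.mul_sum]
    congr 1
    simp only [Finset.sum_mul, ite_mul, zero_mul]
    rw [Finset.sum_comm]
    refine Finset.sum_congr rfl fun x _ => ?_
    rw [Finset.sum_comm]
    exact Finset.sum_congr rfl fun h _ => h1 x h
  rw [h2, Finset.sum_const, Finset.card_univ, nsmul_eq_mul, mul_left_comm, ← mul_assoc,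
    ← mul_assoc, mul_assoc _ (Fintype.card (AlgebraGroup A) : ℂ)⁻¹, inv_mul_cancel₀ hne, mul_one]

end General

section Kirillov

variable {F A : Type*} [Field F] [NonUnitalRing A] [Module F A]
  [IsScalarTower F A A] [SMulCommClass F A A] [IsNilpotentAlgebra A]

theorem kirillov_conj [Fintype (AlgebraGroup A)] (θ : AddChar F ℂ) (lam : Module.Dual F A)
    (x g : AlgebraGroup A) : kirillov θ lam (x * g * x⁻¹) = kirillov θ lam g := by
  rw [kirillov_eq_sum, kirillov_eq_sum]
  congr 1
  refine Fintype.sum_equiv (Equiv.mulRight x) _ _ fun y => ?_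
  rw [thetaFn_conj, ← coadjoint_mul, Equiv.coe_mulRight]

/-- Orthogonality of the `θ_ν` leaves the pairs `(x, y)` with `λ^x = λ^y`, of which there are `|G|`
times the order of the stabilizer. No representation is involved, so the norm is one whether or not
`ψ_λ` is a character. -/
theorem groupInner_kirillov_self [Finite F] [Fintype (AlgebraGroup A)] {θ : AddChar F ℂ}
    (hθ : θ ≠ 1) (lam : Module.Dual F A) :
    groupInner (kirillov θ lam) (kirillov θ lam) = 1 := by
  classical
  have hne : (Fintype.card (AlgebraGroup A) : ℂ) ≠ 0 := Nat.cast_ne_zero.2 Fintype.card_ne_zero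
  set N : ℂ := (Fintype.card (AlgebraGroup A) : ℂ) with hN
  set r : ℂ := (Real.sqrt (Nat.card (coadjointOrbit lam)) : ℂ) with hr
  have hrr : r * r = Nat.card (coadjointOrbit lam) := by
    rw [hr, ← Complex.ofReal_mul, Real.mul_self_sqrt (Nat.cast_nonneg _), Complex.ofReal_natCast]
  have hconj : (starRingEnd ℂ) (r * N⁻¹) = r * N⁻¹ := by
    rw [map_mul, map_inv₀, hN, Complex.conj_natCast, hr, Complex.conj_ofReal]
  have hfib : ∀ x, (∑ y, if coadjoint lam y = coadjoint lam x then N else 0) =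
      N * Nat.card {x // coadjoint lam x = lam} := fun x => by
    have h := card_coadjoint_fiber (MonoidHom.id _) lam x
    simp only [MonoidHom.id_apply] at h
    rw [← h, Nat.card_eq_fintype_card, Fintype.card_subtype, ← Finset.sum_filter, Finset.sum_const, nsmul_eq_mul, mul_comm]
  have hcard : (Nat.card (coadjointOrbit lam) : ℂ) * Nat.card {x // coadjoint lam x = lam} = N := by
    rw [← Nat.cast_mul, card_coadjointOrbit_mul]
  have hsum : ∑ g, kirillov θ lam g * (starRingEnd ℂ) (kirillov θ lam g) =
      (r * N⁻¹) * (r * N⁻¹) * ∑ x, ∑ y, ∑ g,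
        thetaFn θ (coadjoint lam y) g * (starRingEnd ℂ) (thetaFn θ (coadjoint lam x) g) := by
    have hk : ∀ g, kirillov θ lam g = r * N⁻¹ * ∑ x, thetaFn θ (coadjoint lam x) g :=
      kirillov_eq_sum θ lam
    simp only [hk, map_mul (starRingEnd ℂ) (r * N⁻¹), hconj, map_sum]
    simp only [mul_mul_mul_comm (r * N⁻¹), ← Finset.mul_sum]
    congr 1
    simp only [Finset.sum_mul_sum]
    rw [Finset.sum_comm_cycle]
    exact Finset.sum_congr rfl fun _ _ => Finset.sum_comm
  rw [groupInner, finsum_eq_sum_of_fintype, Nat.card_eq_fintype_card, ← hN, hsum]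
  simp only [sum_thetaFn_mul_conj hθ, ← hN, hfib]
  rw [Finset.sum_const, Finset.card_univ, nsmul_eq_mul, ← hN]
  calc _ = (N⁻¹ * N) * (N⁻¹ * N) * N⁻¹ *
        (r * r * Nat.card {x // coadjoint lam x = lam}) := by ring
    _ = 1 := by rw [hrr, hcard, inv_mul_cancel₀ hne, one_mul, one_mul, inv_mul_cancel₀ hne]

end Kirillov

section ThetaHom

variable {F A : Type*} [Field F] [NonUnitalRing A] [Module F A]
  [IsScalarTower F A A] [SMulCommClass F A A] [Module.Finite F A] [IsNilpotentAlgebra A]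

/-- The linear character `θ_λ` of `L̄`. -/
noncomputable def thetaHom (θ : AddChar F ℂ) (lam : Module.Dual F A) : AlgebraGroup (lBar lam) →* ℂ where
  toFun k := thetaFn θ lam (incl (lBar lam) k)
  map_one' := by
    rw [map_one, thetaFn, val_one, map_zero, AddChar.map_zero_eq_one]
  map_mul' k k' := by
    rw [map_mul, thetaFn, val_mul, map_add lam, map_add lam, incl_val, incl_val,
      apply_lBar_mul_sBar k.val.2 (lBar_le_sBar lam k'.val.2), add_zero, AddChar.map_add_eq_mul]
    rfl

theorem thetaHom_inv (θ : AddChar F ℂ) (lam : Module.Dual F A) (k : AlgebraGroup (lBar lam)) :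
    thetaHom θ lam k⁻¹ = θ (-lam k.val) := by
  have h : lam ((k⁻¹).val : A) = -lam k.val := by
    have h1 : (k.val : A) + (k⁻¹).val + k.val * (k⁻¹).val = 0 :=
      congrArg Subtype.val (val_inv_add k)
    have h2 := congrArg lam h1
    rw [map_add, map_add, apply_lBar_mul_sBar k.val.2 (lBar_le_sBar lam k⁻¹.val.2), add_zero,
      map_zero] at h2
    exact eq_neg_of_add_eq_zero_right h2
  rw [← h]
  rfl

/-- `L̄` is normal in `S̄`, and `λ^s = λ` on `𝔩̄` for `s ∈ S̄`; this is what the isotypic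
construction requires. -/
theorem exists_conj_lBar (θ : AddChar F ℂ) (lam : Module.Dual F A) (s : AlgebraGroup (sBar lam)) :
    ∃ c : AlgebraGroup (lBar lam) → AlgebraGroup (lBar lam), ∀ k,
      incl (lBar lam) (c k) = incl (sBar lam) s * incl (lBar lam) k * (incl (sBar lam) s)⁻¹ ∧
        thetaHom θ lam (c k) = thetaHom θ lam k := by
  have hmem : ∀ k, (incl (sBar lam) s * incl (lBar lam) k * (incl (sBar lam) s)⁻¹).val ∈
      lBar lam := fun k => by
    have h1 : rightMul F (incl (sBar lam) s)⁻¹ (k.val : A) ∈ lBar lam :=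
      add_mem k.val.2 (mul_mem_lBar_right k.val.2 (inv_val_mem s.val.2))
    rw [val_conj (F := F)]
    exact add_mem h1 (mul_mem_lBar_left s.val.2 h1)
  refine ⟨fun k => ⟨⟨_, hmem k⟩⟩, fun k => ⟨rfl, ?_⟩⟩
  change thetaFn θ lam (incl (sBar lam) s * incl (lBar lam) k * (incl (sBar lam) s)⁻¹) =
    thetaFn θ lam (incl (lBar lam) k)
  rw [thetaFn_conj]
  -- `Y = 0` is the case `λ' = λ`.
  exact congrArg θ (coadjoint_apply_of_val_mem_sBar (Y := 0) (zero_mem _)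
    (fun X => by rw [mul_zero, map_zero, add_zero]) s.val.2 k.val.2)

end ThetaHom

/-! ### Induction, multiplicity and irreducibility -/

section Main

variable {F A : Type*} [Field F] [Finite F] [NonUnitalRing A] [Module F A]
  [IsScalarTower F A A] [SMulCommClass F A A] [Module.Finite F A] [IsNilpotentAlgebra A]
  {lam lam' : Module.Dual F A} {Y : A} {θ : AddChar F ℂ}
  [Fintype (AlgebraGroup A)] [Fintype (AlgebraGroup (sBar lam))]

theorem sqrt_card_coadjointOrbit_mul (hY : Y ∈ sBar lam)
    (h' : ∀ X, lam' X = lam X + lam (X * Y)) :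
    (Real.sqrt (Nat.card (coadjointOrbit lam')) : ℂ) * Fintype.card (AlgebraGroup (sBar lam)) =
      (Real.sqrt (Nat.card (coadjointOrbit (res lam' (sBar lam)))) : ℂ) *
        Fintype.card (AlgebraGroup A) := by
  have h := congrArg (fun n : ℕ => Real.sqrt (n : ℝ)) (card_coadjointOrbit_mul_sq hY h')
  simp only [Nat.cast_mul, Nat.cast_pow] at h
  rw [Real.sqrt_mul (Nat.cast_nonneg _), Real.sqrt_mul (Nat.cast_nonneg _),
    Real.sqrt_sq (Nat.cast_nonneg _), Real.sqrt_sq (Nat.cast_nonneg _)] at h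
  exact_mod_cast congrArg (fun t : ℝ => (t : ℂ)) h

theorem ind_kirillov [Fintype (AlgebraGroup (lBar lam))] (hθ : θ ≠ 1) (hY : Y ∈ sBar lam)
    (h' : ∀ X, lam' X = lam X + lam (X * Y)) :
    ind (sBar lam) (kirillov θ (res lam' (sBar lam))) = kirillov θ lam' := by
  classical
  funext g
  let S := sBar lam
  let i := incl S
  have hS : (Fintype.card (AlgebraGroup S) : ℂ) ≠ 0 := Nat.cast_ne_zero.2 Fintype.card_ne_zero
  have hG : (Fintype.card (AlgebraGroup A) : ℂ) ≠ 0 := Nat.cast_ne_zero.2 Fintype.card_ne_zero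
  have hL : (Fintype.card (AlgebraGroup (lBar lam)) : ℂ) ≠ 0 :=
    Nat.cast_ne_zero.2 Fintype.card_ne_zero
  -- All `S̄`-conjugates of `θ_μ'` have the same induced function, so inducing `ψ_μ'` amounts to
  -- inducing `θ_μ'`, up to a constant.
  have hconj : ∀ s, (∑ x, ∑ h, if i h = x * g * x⁻¹ then
      thetaFn θ (coadjoint (res lam' S) s) h else 0) =
      ∑ x, ∑ h, if i h = x * g * x⁻¹ then thetaFn θ (res lam' S) h else 0 := by
    intro s
    refine Fintype.sum_equiv (Equiv.mulLeft (i s)) _ _ fun x => ?_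
    refine Fintype.sum_equiv (MulAut.conj s).toEquiv _ _ fun h => ?_
    simp only [MulEquiv.toEquiv_eq_coe, EquivLike.coe_coe, MulAut.conj_apply, Equiv.coe_mulLeft]
    rw [thetaFn_conj]
    refine if_congr ?_ rfl rfl
    rw [map_mul, map_mul, map_inv, mul_inv_rev]
    constructor
    · intro e
      rw [e]
      group
    · intro e
      have e' : i s * i h * (i s)⁻¹ = i s * (x * g * x⁻¹) * (i s)⁻¹ := by rw [e]; group
      exact mul_left_cancel (mul_right_cancel e')
  -- The extension of `θ_μ'` by zero is the `L̄`-average of `θ_λ'`. In the sum over `G` this average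
  -- is then absorbed by `x ↦ kx`.
  have htrunc : ∀ x, (∑ h, if i h = x * g * x⁻¹ then thetaFn θ (res lam' S) h else 0) =
      (Fintype.card (AlgebraGroup (lBar lam)) : ℂ)⁻¹ * ∑ k, thetaFn θ lam'
        (incl (lBar lam) k * (x * g * x⁻¹) * (incl (lBar lam) k)⁻¹) := by
    intro x
    rw [sum_ite_incl_eq, sum_thetaFn_conj_lBar hθ hY h']
    split_ifs with hx
    · rw [inv_mul_cancel_left₀ hL]
      rfl
    · rw [mul_zero]
  have hsum : (∑ x, ∑ h, if i h = x * g * x⁻¹ then thetaFn θ (res lam' S) h else 0) =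
      ∑ x, thetaFn θ (coadjoint lam' x) g := by
    simp only [htrunc]
    rw [← Finset.mul_sum, Finset.sum_comm]
    have h1 : ∀ k, ∑ x, thetaFn θ lam'
        (incl (lBar lam) k * (x * g * x⁻¹) * (incl (lBar lam) k)⁻¹) =
        ∑ x, thetaFn θ (coadjoint lam' x) g := fun k => by
      refine Fintype.sum_equiv (Equiv.mulLeft (incl (lBar lam) k)) _ _ fun x => ?_
      rw [Equiv.coe_mulLeft, ← thetaFn_conj]
      congr 1
      group
    simp only [h1]
    rw [Finset.sum_const, Finset.card_univ, nsmul_eq_mul, inv_mul_cancel_left₀ hL]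
  have hk : ∀ h, kirillov θ (res lam' S) h =
      (Real.sqrt (Nat.card (coadjointOrbit (res lam' S))) : ℂ) *
        (Fintype.card (AlgebraGroup S) : ℂ)⁻¹ *
        ∑ s, thetaFn θ (coadjoint (res lam' S) s) h := kirillov_eq_sum θ _
  rw [ind_eq_sum, kirillov_eq_sum, ← hsum]
  have h2 : (∑ x, ∑ h, if i h = x * g * x⁻¹ then kirillov θ (res lam' S) h else 0) =
      (Real.sqrt (Nat.card (coadjointOrbit (res lam' S))) : ℂ) *
      ∑ x, ∑ h, if i h = x * g * x⁻¹ then thetaFn θ (res lam' S) h else 0 := by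
    calc _ = ∑ x, ∑ h, (Real.sqrt (Nat.card (coadjointOrbit (res lam' S))) : ℂ) *
          (Fintype.card (AlgebraGroup S) : ℂ)⁻¹ * ∑ s, (if i h = x * g * x⁻¹ then
            thetaFn θ (coadjoint (res lam' S) s) h else 0) := by
          refine Finset.sum_congr rfl fun x _ => Finset.sum_congr rfl fun h _ => ?_
          split_ifs
          · rw [hk]
          · rw [Finset.sum_const_zero, mul_zero]
      _ = (Real.sqrt (Nat.card (coadjointOrbit (res lam' S))) : ℂ) *
          (Fintype.card (AlgebraGroup S) : ℂ)⁻¹ * ∑ s, ∑ x, ∑ h, (if i h = x * g * x⁻¹ then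
            thetaFn θ (coadjoint (res lam' S) s) h else 0) := by
          simp only [← Finset.mul_sum]
          rw [Finset.sum_comm_cycle]
      _ = _ := by
          simp only [hconj]
          rw [Finset.sum_const, Finset.card_univ, nsmul_eq_mul, mul_assoc,
            inv_mul_cancel_left₀ hS]
  erw [h2]
  rw [← mul_assoc]
  congr 1
  have h3 := sqrt_card_coadjointOrbit_mul hY h'
  change _ * (Fintype.card (AlgebraGroup S) : ℂ) = _ at h3
  rw [inv_mul_eq_iff_eq_mul₀ hS, ← mul_assoc, eq_mul_inv_iff_mul_eq₀ hG, ← h3, mul_comm]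

/-- Frobenius reciprocity moves the product to `L̄`, where orthogonality keeps exactly the `x` with
`λ'^x = λ` on `𝔩̄`, that is `x ∈ S̄`. The value `√|λ'^G| |S̄| / |G|` is rewritten by the orbit
comparison. -/
theorem groupInner_xi_kirillov [Fintype (AlgebraGroup (lBar lam))] (hθ : θ ≠ 1)
    (hY : Y ∈ sBar lam) (h' : ∀ X, lam' X = lam X + lam (X * Y)) :
    groupInner (xi θ lam) (kirillov θ lam') =
      (Real.sqrt (Nat.card (coadjointOrbit (res lam' (sBar lam)))) : ℂ) := by
  classical
  have hG : (Fintype.card (AlgebraGroup A) : ℂ) ≠ 0 := Nat.cast_ne_zero.2 Fintype.card_ne_zero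
  have hL : (Fintype.card (AlgebraGroup (lBar lam)) : ℂ) ≠ 0 :=
    Nat.cast_ne_zero.2 Fintype.card_ne_zero
  rw [xi, groupInner_ind _ _ _ (kirillov_conj θ lam'), groupInner, finsum_eq_sum_of_fintype,
    Nat.card_eq_fintype_card]
  have h3 := sqrt_card_coadjointOrbit_mul hY h'
  set r : ℂ := (Real.sqrt (Nat.card (coadjointOrbit lam')) : ℂ) with hr
  set N : ℂ := (Fintype.card (AlgebraGroup A) : ℂ) with hN
  have hconj : (starRingEnd ℂ) (r * N⁻¹) = r * N⁻¹ := by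
    rw [map_mul, map_inv₀, hN, Complex.conj_natCast, hr, Complex.conj_ofReal]
  have hk : ∀ g, kirillov θ lam' g = r * N⁻¹ * ∑ x, thetaFn θ (coadjoint lam' x) g :=
    kirillov_eq_sum θ lam'
  have hx : ∀ x, res lam (lBar lam) = res (coadjoint lam' x) (lBar lam) ↔ x.val ∈ sBar lam := by
    intro x
    rw [← forall_lBar_coadjoint_eq_iff hY h', LinearMap.ext_iff, Subtype.forall]
    exact forall₂_congr fun X _ => eq_comm
  have h1 : ∑ h, thetaFn θ lam (incl (lBar lam) h) *
      (starRingEnd ℂ) (kirillov θ lam' (incl (lBar lam) h)) =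
      r * N⁻¹ * ∑ x, ∑ h, thetaFn θ (res lam (lBar lam)) h *
        (starRingEnd ℂ) (thetaFn θ (res (coadjoint lam' x) (lBar lam)) h) := by
    simp only [hk, map_mul (starRingEnd ℂ) (r * N⁻¹), hconj, map_sum]
    rw [Finset.sum_comm, Finset.mul_sum]
    refine Finset.sum_congr rfl fun h _ => ?_
    rw [mul_left_comm, Finset.mul_sum]
    rfl
  rw [h1]
  simp only [sum_thetaFn_mul_conj hθ, hx]
  rw [sum_ite_mem (sBar lam) fun _ => (Fintype.card (AlgebraGroup (lBar lam)) : ℂ),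
    Finset.sum_const, Finset.card_univ, nsmul_eq_mul]
  calc _ = ((Fintype.card (AlgebraGroup (lBar lam)) : ℂ)⁻¹ *
        (Fintype.card (AlgebraGroup (lBar lam)) : ℂ)) * N⁻¹ *
        (r * (Fintype.card (AlgebraGroup (sBar lam)) : ℂ)) := by ring
    _ = _ := by rw [h3, inv_mul_cancel₀ hL, one_mul, mul_comm, mul_assoc, mul_inv_cancel₀ hG,
        mul_one]

/-- The `θ_λ`-isotypic part of `ψ_{λ'}` under `L̄` is the Kirillov function of the restriction. -/
theorem isotypic_kirillov [Fintype (AlgebraGroup (lBar lam))] (hθ : θ ≠ 1)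
    (hY : Y ∈ sBar lam) (h' : ∀ X, lam' X = lam X + lam (X * Y)) (s : AlgebraGroup (sBar lam)) :
    (Fintype.card (AlgebraGroup (lBar lam)) : ℂ)⁻¹ * ∑ k, thetaHom θ lam k⁻¹ *
      kirillov θ lam' (incl (sBar lam) s * incl (lBar lam) k) =
      kirillov θ (res lam' (sBar lam)) s := by
  classical
  have hG : (Fintype.card (AlgebraGroup A) : ℂ) ≠ 0 := Nat.cast_ne_zero.2 Fintype.card_ne_zero
  have hS : (Fintype.card (AlgebraGroup (sBar lam)) : ℂ) ≠ 0 :=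
    Nat.cast_ne_zero.2 Fintype.card_ne_zero
  have hL : (Fintype.card (AlgebraGroup (lBar lam)) : ℂ) ≠ 0 :=
    Nat.cast_ne_zero.2 Fintype.card_ne_zero
  have : Fintype (lBar lam) := Fintype.ofEquiv _ (valEquiv (lBar lam))
  have hleft : ∀ t : AlgebraGroup (sBar lam), ∀ U ∈ lBar lam,
      leftMul F (incl (sBar lam) t) U ∈ lBar lam := fun t U hU =>
    add_mem hU (mul_mem_lBar_left t.val.2 hU)
  have hlam : ∀ t : AlgebraGroup (sBar lam), ∀ U ∈ lBar lam,
      lam (leftMul F (incl (sBar lam) t) U) = lam U := fun t U hU => by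
    rw [leftMul_apply, map_add, incl_val, apply_sBar_mul_lBar t.val.2 hU, add_zero]
  -- `η x U = λ'^x(sU) - λ(U)` is the part of the exponent depending on `k = 1 + U`. Since `U ↦ sU`
  -- permutes `𝔩̄` and preserves `λ` there, `η x = 0` means `λ'^x = λ` on `𝔩̄`.
  let η : AlgebraGroup A → Module.Dual F (lBar lam) := fun x =>
    res (coadjoint lam' x ∘ₗ leftMul F (incl (sBar lam) s) - lam) (lBar lam)
  have hη : ∀ x, η x = 0 ↔ x.val ∈ sBar lam := by
    intro x
    rw [← forall_lBar_coadjoint_eq_iff hY h']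
    constructor
    · intro h X hX
      have h1 := LinearMap.congr_fun h ⟨_, hleft s⁻¹ X hX⟩
      have h2 : coadjoint lam' x (leftMul F (incl (sBar lam) s)
          (leftMul F (incl (sBar lam) s⁻¹) X)) - lam (leftMul F (incl (sBar lam) s⁻¹) X) = 0 := h1
      rwa [← leftMul_mul, ← map_mul, mul_inv_cancel, map_one, leftMul_one, hlam _ X hX,
        sub_eq_zero] at h2
    · intro h
      refine LinearMap.ext fun U => ?_
      change coadjoint lam' x (leftMul F (incl (sBar lam) s) U) - lam U = 0
      rw [h _ (hleft s U U.2), hlam s U U.2, sub_self]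
  have hterm : ∀ x k, thetaHom θ lam k⁻¹ *
      thetaFn θ (coadjoint lam' x) (incl (sBar lam) s * incl (lBar lam) k) =
      thetaFn θ (coadjoint lam' x) (incl (sBar lam) s) * θ (η x k.val) := by
    intro x k
    rw [thetaHom_inv, thetaFn, thetaFn, ← AddChar.map_add_eq_mul, ← AddChar.map_add_eq_mul, val_mul]
    congr 1
    change _ = _ + (coadjoint lam' x (leftMul F (incl (sBar lam) s) k.val) - lam k.val)
    rw [leftMul_apply, map_add, map_add, map_add, incl_val (lBar lam)]
    abel
  have hsum : ∀ x, ∑ k, thetaHom θ lam k⁻¹ *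
      thetaFn θ (coadjoint lam' x) (incl (sBar lam) s * incl (lBar lam) k) =
      if x.val ∈ sBar lam then (Fintype.card (AlgebraGroup (lBar lam)) : ℂ) *
        thetaFn θ (coadjoint lam' x) (incl (sBar lam) s) else 0 := by
    intro x
    simp only [hterm]
    rw [← Finset.mul_sum, show ∑ k : AlgebraGroup (lBar lam), θ (η x k.val) = ∑ U, θ (η x U) from
      (valEquiv (lBar lam)).sum_comp fun U => θ (η x U), sum_addChar_comp_dual hθ,
      Fintype.card_congr (valEquiv (lBar lam))]
    simp only [hη]
    split_ifs
    · rw [mul_comm]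
    · rw [mul_zero]
  have hk : ∀ k, thetaHom θ lam k⁻¹ * kirillov θ lam' (incl (sBar lam) s * incl (lBar lam) k) =
      (Real.sqrt (Nat.card (coadjointOrbit lam')) : ℂ) * (Fintype.card (AlgebraGroup A) : ℂ)⁻¹ *
        ∑ x, thetaHom θ lam k⁻¹ *
          thetaFn θ (coadjoint lam' x) (incl (sBar lam) s * incl (lBar lam) k) := fun k => by
    rw [kirillov_eq_sum, mul_left_comm, Finset.mul_sum]
  simp only [hk]
  rw [← Finset.mul_sum, Finset.sum_comm]
  simp only [hsum]
  rw [sum_ite_mem (sBar lam) fun x => (Fintype.card (AlgebraGroup (lBar lam)) : ℂ) *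
    thetaFn θ (coadjoint lam' x) (incl (sBar lam) s), ← Finset.mul_sum, kirillov_eq_sum]
  simp only [coadjoint_res, thetaFn_res]
  have h3 := sqrt_card_coadjointOrbit_mul hY h'
  generalize (∑ h, thetaFn θ (coadjoint lam' (incl (sBar lam) h)) (incl (sBar lam) s)) = T
  rw [← eq_mul_inv_iff_mul_eq₀ hS] at h3
  rw [h3]
  field_simp

/-- Both functions have norm one, so only the property of being a character has to be transported:
downwards by isotypic parts, upwards by induction. -/
theorem isIrreducibleCharacter_kirillov_iff [Fintype (AlgebraGroup (lBar lam))] (hθ : θ ≠ 1)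
    (hY : Y ∈ sBar lam) (h' : ∀ X, lam' X = lam X + lam (X * Y)) :
    IsIrreducibleCharacter (kirillov θ lam') ↔
      IsIrreducibleCharacter (kirillov θ (res lam' (sBar lam))) := by
  classical
  constructor
  · rintro ⟨n, ρ, -, hρ⟩
    refine isIrreducibleCharacter_of_groupInner ?_ (groupInner_kirillov_self hθ _)
    obtain ⟨m, σ, hσ⟩ := ρ.exists_character_eq_isotypic (incl (lBar lam))
      (incl_injective _) (incl (sBar lam)) (thetaHom θ lam) (exists_conj_lBar θ lam)
    refine ⟨m, σ, hσ.trans (funext fun s => ?_)⟩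
    rw [hρ]
    exact isotypic_kirillov hθ hY h' s
  · rintro ⟨n, ρ, -, hρ⟩
    refine isIrreducibleCharacter_of_groupInner ?_ (groupInner_kirillov_self hθ _)
    obtain ⟨m, σ, hσ⟩ := ρ.exists_character_eq_induced (incl (sBar lam))
    refine ⟨m, σ, hσ.trans (funext fun g => ?_)⟩
    rw [← ind_kirillov hθ hY h', ind_eq_sum, hρ, Nat.card_eq_fintype_card]

end Main

end AlgebraGroup

theorem mainTheorem5 {F : Type*} [Field F] [Finite F]
    {A : Type*} [NonUnitalRing A] [Module F A] [IsScalarTower F A A] [SMulCommClass F A A]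
    [Module.Finite F A] [IsNilpotentAlgebra A]
    (θ : AddChar F ℂ) (hθ : θ ≠ 1) (lam lam' : Module.Dual F A) :
    (res lam' (sBar lam) ∈ rightOrbit (res lam (sBar lam)) ↔
      lam' ∈ subgroupOrbit lam (sBar lam)) ∧
    (lam' ∈ subgroupOrbit lam (sBar lam) →
      ind (sBar lam) (kirillov θ (res lam' (sBar lam))) = kirillov θ lam' ∧
      (∃ n : ℕ, 0 < n ∧ groupInner (xi θ lam) (kirillov θ lam') = (n : ℂ)) ∧
      (IsIrreducibleCharacter (kirillov θ lam') ↔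
        IsIrreducibleCharacter (kirillov θ (res lam' (sBar lam))))) := by
  have hA : Finite A := Module.finite_of_finite F
  have hfin : ∀ (B : Type _) [Finite B], Finite (AlgebraGroup B) := fun B _ =>
    Finite.of_equiv B (valEquiv B).symm
  have := @Fintype.ofFinite _ (hfin A)
  have := @Fintype.ofFinite _ (hfin (sBar lam))
  have := @Fintype.ofFinite _ (hfin (lBar lam))
  refine ⟨res_mem_rightOrbit_iff lam lam', fun h => ?_⟩
  obtain ⟨Y, hY, h'⟩ := mem_subgroupOrbit_iff.1 h
  refine ⟨ind_kirillov hθ hY h', ?_, isIrreducibleCharacter_kirillov_iff hθ hY h'⟩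
  have : Module.Finite F (sBar lam) := inferInstanceAs (Module.Finite F (sBar lam).toSubmodule)
  obtain ⟨m, hm, hcard⟩ := exists_card_coadjointOrbit_eq_sq (res lam' (sBar lam))
  refine ⟨m, hm, ?_⟩
  rw [groupInner_xi_kirillov hθ hY h', hcard, Nat.cast_mul, Real.sqrt_mul_self (Nat.cast_nonneg _),
    Complex.ofReal_natCast]
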